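/- Let $D=\{(r,z): r\ge 0,\ r^2+z^2\le 1\}$ be the meridional half disc of the unit ball $B\subset\mathbb R^3$, and let $G_B(x,y)=\frac1{4\pi|x-y|}-\frac1{4\pi|y||x-y^*|}$, $y^*=y/|y|^2$, be the Dirichlet Green's function of $-\Delta$ on $B$. For $w=\omega^\theta/r$ on $D$ let the axisymmetric swirl-free velocity be given by the Biot–Savart law $$u^r(\bar r,\bar z)=-\frac1{\bar r}\int_D r\,\partial_{\bar z}\mathcal G\, w\,dr\,dz,\qquad u^z(\bar r,\bar z)=\frac1{\bar r}\int_D r\,\partial_{\bar r}\mathcal G\, w\,dr\,dz,$$ $$\mathcal G(\bar r,\bar z,r,z)=\int_0^{2\pi} r\bar r\cos\theta\; G_B\big((\bar r,0,\bar z),(r\cos\theta,r\sin\theta,z)\big)\,d\theta .$$ Let $e_1=(1,0)$, and for $0<\gamma<\pi/2$ let $D_1^\gamma$ (resp. $D_2^\gamma$) be the set of points $(1-\rho\sin\phi,\rho\cos\phi)\in D$ with $\rho\ge0$ and $0\le\phi\le\pi/2-\gamma$ (resp. $\gamma\le\phi\le\pi/2$). For $0<N<1/2$ and $x=(\bar r,\bar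 z)$ let $Q(x)=\{1-N<r<\bar r,\ \bar z<z<N\}\cap D$. Then for all $0<N<1/2$ and $0<\gamma<\pi/2$ there are $\delta>0$ and $C$, depending only on $\gamma$ and $N$, such that the following holds for every $w\in L^\infty(D)$ that is odd in $z$. For all $x=(\bar r,\bar z)\in D_1^\gamma$ with $|x-e_1|<\delta$, $$u^z(x)=-\frac4\pi\,\bar z\int_{Q(x)}\frac{(1-r)z}{((1-r)^2+z^2)^2}\,w(r,z)\,dr\,dz+\bar z\,B_1(x),\qquad |B_1(x)|\le C\|w\|_{L^\infty(D)},$$ and for all $x\in D_2^\gamma$ with $|x-e_1|<\delta$, $$u^r(x)=-\frac4\pi\,(1-\bar r)\int_{Q(x)}\frac{(1-r)z}{((1-r)^2+z^2)^2}\,w(r,z)\,dr\,dz+(1-\bar r)\,B_2(x),\qquad |B_2(x)|\le C\|w\|_{L^\infty(D)}.$$ Moreover, let $w$ be a classical solution on $D\times[0,\infty)$ of the axisymmetric Euler equations without swirl in $B$: $w\in C^1(D\times[0,\infty))$ and $\partial_tw+u^r\partial_rw+u^z\partial_zw=0$, where the velocity $u$ is continuous on $D\times[0,\infty)$, is given for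 $r>0$ by the Biot–Savart law above applied to $w(\cdot,t)$, and satisfies $u^r=0$ on the axis $r=0$. Then at every time $t\ge0$ at which $w(\cdot,t)$ is odd in $z$, both expansions hold for $u(\cdot,t)$ and $w(\cdot,t)$, with the same $\delta$ and $C$ and with $|B_1|,|B_2|\le C\|w(\cdot,0)\|_{L^\infty(D)}$. -/

import Mathlib

open MeasureTheory Set Real

noncomputable section

namespace AxisymEuler

/-- The closed half disc `D`: the meridional slice of the closed unit ball of `ℝ³`.
A point is a pair `(r, z)`. -/
def halfDisc : Set (ℝ × ℝ) := {y | 0 ≤ y.1 ∧ y.1 ^ 2 + y.2 ^ 2 ≤ 1}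

/-- The measure `dr dz` on `D`. -/
def areaD : Measure (ℝ × ℝ) := (volume : Measure (ℝ × ℝ)).restrict halfDisc

/-- The `L^∞(D)` norm. -/
def supNormD (w : ℝ × ℝ → ℝ) : ℝ := (eLpNorm w ⊤ areaD).toReal

/-- The point of `ℝ³` with cylindrical coordinates `(r, θ, z)`. -/
def cyl (r θ z : ℝ) : EuclideanSpace ℝ (Fin 3) := !₂[r * cos θ, r * sin θ, z]

/-- The Dirichlet Green's function of `-Δ` on the unit ball of `ℝ³`,
`1 / (4π|x-y|) - 1 / (4π|y||x-y*|)` with `y* = y / |y|²`. -/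
def greenBall (x y : EuclideanSpace ℝ (Fin 3)) : ℝ :=
  1 / (4 * π * ‖x - y‖) - 1 / (4 * π * ‖y‖ * ‖x - (‖y‖ ^ 2)⁻¹ • y‖)

/-- The axisymmetric Green's function `𝒢(x, y)`, `x = (r̄, z̄)`, `y = (r, z)`:
`𝒢 = ∫₀^{2π} r r̄ cos θ G_B dθ`. The stream function of the vorticity `ω^θ` is
`ψ(x) = ∫_D 𝒢(x, y) ω^θ(y) dy`. -/
def axisymGreen (x y : ℝ × ℝ) : ℝ :=
  ∫ θ in (0 : ℝ)..(2 * π), y.1 * x.1 * cos θ * greenBall (cyl x.1 0 x.2) (cyl y.1 θ y.2)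

/-- Biot–Savart law, radial component `u^r = -ψ_z / r`, for `w = ω^θ / r`. -/
def velR (w : ℝ × ℝ → ℝ) (x : ℝ × ℝ) : ℝ :=
  -(1 / x.1 * ∫ y in halfDisc, y.1 * deriv (fun s => axisymGreen (x.1, s) y) x.2 * w y)

/-- Biot–Savart law, axial component `u^z = ψ_r / r`, for `w = ω^θ / r`. -/
def velZ (w : ℝ × ℝ → ℝ) (x : ℝ × ℝ) : ℝ :=
  1 / x.1 * ∫ y in halfDisc, y.1 * deriv (fun s => axisymGreen (s, x.2) y) x.1 * w y

/-- `w` is odd in `z` (almost everywhere in `D`). -/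
def OddInZ (w : ℝ × ℝ → ℝ) : Prop := ∀ᵐ y ∂areaD, w (y.1, -y.2) = -w y

/-- The Euclidean distance from `x` to `e₁ = (1, 0)`. -/
def distE1 (x : ℝ × ℝ) : ℝ := √((x.1 - 1) ^ 2 + x.2 ^ 2)

/-- The part of `D` where the angle `φ` at `e₁`, measured from the half line `r = 1`, `z ≥ 0`
towards the half line `z = 0`, `r ≤ 1`, lies in `[a, b]`. -/
def sectorE1 (a b : ℝ) : Set (ℝ × ℝ) :=
  {x | x ∈ halfDisc ∧ ∃ ρ φ : ℝ, 0 ≤ ρ ∧ a ≤ φ ∧ φ ≤ b ∧ x = (1 - ρ * sin φ, ρ * cos φ)}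

/-- `D₁^γ`. -/
def D1 (γ : ℝ) : Set (ℝ × ℝ) := sectorE1 0 (π / 2 - γ)

/-- `D₂^γ`. -/
def D2 (γ : ℝ) : Set (ℝ × ℝ) := sectorE1 γ (π / 2)

/-- `Q(r̄, z̄) = {1 - N < r < r̄, z̄ < z < N} ∩ D`. -/
def Q (N : ℝ) (x : ℝ × ℝ) : Set (ℝ × ℝ) :=
  {y | y ∈ halfDisc ∧ 1 - N < y.1 ∧ y.1 < x.1 ∧ x.2 < y.2 ∧ y.2 < N}

/-- `∫_{Q(x)} (1-r) z / ((1-r)² + z²)² w(r, z) dr dz`. -/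
def mainIntegral (N : ℝ) (w : ℝ × ℝ → ℝ) (x : ℝ × ℝ) : ℝ :=
  ∫ y in Q N x, (1 - y.1) * y.2 / ((1 - y.1) ^ 2 + y.2 ^ 2) ^ 2 * w y

/-- The two expansions near `e₁`, at distance less than `δ`, of a velocity field `(ur, uz)` with
vorticity function `w`, with remainders bounded by `M`. -/
def VelocityExpansion (N γ δ M : ℝ) (w ur uz : ℝ × ℝ → ℝ) : Prop :=
  (∀ x ∈ D1 γ, distE1 x < δ → ∃ B₁ : ℝ, |B₁| ≤ M ∧
    uz x = -(4 / π) * x.2 * mainIntegral N w x + x.2 * B₁) ∧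
  (∀ x ∈ D2 γ, distE1 x < δ → ∃ B₂ : ℝ, |B₂| ≤ M ∧
    ur x = -(4 / π) * (1 - x.1) * mainIntegral N w x + (1 - x.1) * B₂)

/-- Classical solutions on `D × [0, ∞)` of the axisymmetric Euler equations without swirl in the
unit ball: `(∂_t + u^r ∂_r + u^z ∂_z) w = 0`, where the continuous velocity `u = (ur, uz)` is
given off the axis by the Biot–Savart law of the ball, and `u^r = 0` on the axis. -/
structure IsEulerSolution (w ur uz : ℝ → ℝ × ℝ → ℝ) : Prop where
  contDiffOn_w : ContDiffOn ℝ 1 (fun p : ℝ × (ℝ × ℝ) => w p.1 p.2) (Ici 0 ×ˢ halfDisc)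
  continuousOn_ur : ContinuousOn (fun p : ℝ × (ℝ × ℝ) => ur p.1 p.2) (Ici 0 ×ˢ halfDisc)
  continuousOn_uz : ContinuousOn (fun p : ℝ × (ℝ × ℝ) => uz p.1 p.2) (Ici 0 ×ˢ halfDisc)
  biotSavart_r : ∀ t, 0 ≤ t → ∀ x ∈ halfDisc, 0 < x.1 → ur t x = velR (w t) x
  biotSavart_z : ∀ t, 0 ≤ t → ∀ x ∈ halfDisc, 0 < x.1 → uz t x = velZ (w t) x
  axis : ∀ t, 0 ≤ t → ∀ x ∈ halfDisc, x.1 = 0 → ur t x = 0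
  transport : ∀ t, 0 ≤ t → ∀ x ∈ halfDisc,
    fderivWithin ℝ (fun p : ℝ × (ℝ × ℝ) => w p.1 p.2) (Ici 0 ×ˢ halfDisc) (t, x)
      (1, ur t x, uz t x) = 0

end AxisymEuler

end

noncomputable section

namespace AxisymEuler

/-! ### Second order expansions of inverse powers -/

/-! Write q = |y|², R = |e₁ - y| and ρ = |x - e₁|. Since w is odd in z, only the odd part K(y) -
K(r, -z) of a velocity kernel acts on it. When R ≥ 8ρ the kernel is expanded to first order in x
about e₁. Because e₁ lies on the sphere, the direct and the image distance coincide there, so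
everything is a polynomial times powers of a⁻¹ with a = |e₁ - y_θ|. The zeroth order terms cancel or
are even in z. Of the first order terms only one survives: ∓6 z z̄ (1 - q) a⁻⁵ for u^z, and its
analogue with 1 - r̄ for u^r (`greenDr_odd_expansion`, `greenDz_odd_expansion`). Integrating in θ,
with ∫ cos θ a⁻⁵ dθ ≈ (4/3) R⁻⁴ and 1 - q ≈ 2(1 - r), gives the kernel -(4/π) c (1 - r) z / R⁴,
where c = z̄ or c = 1 - r̄ (`abs_kerZ_odd_le`, `abs_kerR_odd_le`). The errors are ρ² R⁻³ and ρ R⁻¹.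

In the plane, ρ² R⁻³ over R ≥ 8ρ and ρ R⁻¹ over D both integrate to O(ρ). So does the crude bound |x
- y|⁻¹ on the kernel over R < 8ρ. Replacing {z > 0} by Q costs only a region with R ≥ N and the
strips 1 - r ≤ ρ and z ≤ ρ, again O(ρ) after multiplication by c. Thus the error is O(ρ ‖w‖)
whenever z̄ ≥ 0 (`abs_kernel_add_mainIntegral_le`). The sector hypothesis enters only at the end:
there ρ sin γ ≤ c, so the error can be written as c times a bounded factor.

For Euler solutions what remains is ‖w(t)‖ ≤ ‖w(0)‖. This is a maximum principle for the transport
equation (`le_of_transport`); it uses no flow map, only that the velocity is tangent to the boundary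
of D. Tangency on the sphere holds for the kernel itself (`vel_tangent`). -/

lemma abs_inv_taylor {a b : ℝ} (ha : 0 < a) (hab : a ≤ 2 * b) :
    |b⁻¹ - a⁻¹ + (b ^ 2 - a ^ 2) / 2 * a⁻¹ ^ 3| ≤ 3 * (b ^ 2 - a ^ 2) ^ 2 * a⁻¹ ^ 5 := by
  have hb : 0 < b := by linarith
  -- The Taylor remainder of s ↦ s^(-1/2) at s = a² carries the exact factor (b - a)², to be
  -- compared with (b² - a²)² = (b - a)² (b + a)². Squares are used because the squared distances
  -- are polynomials in x.
  have h1 : b⁻¹ - a⁻¹ + (b ^ 2 - a ^ 2) / 2 * a⁻¹ ^ 3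
      = (b - a) ^ 2 * ((b + 2 * a) / (2 * b * a ^ 3)) := by
    field_simp
    ring
  have h2 : (b + 2 * a) / (2 * b * a ^ 3) ≤ 3 * (b + a) ^ 2 / a ^ 5 := by
    rw [div_le_div_iff₀ (by positivity) (by positivity)]
    have : (b + 2 * a) * a ^ 2 ≤ 3 * (b + a) ^ 2 * (2 * b) := by
      have e : (b + 2 * a) * a ^ 2 ≤ 5 * b * a ^ 2 := by gcongr; linarith
      nlinarith [mul_pos hb hb, mul_pos ha hb, mul_pos (mul_pos hb hb) hb,
        mul_pos (mul_pos ha hb) hb, mul_pos (mul_pos ha hb) ha]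
    calc (b + 2 * a) * a ^ 5 = (b + 2 * a) * a ^ 2 * a ^ 3 := by ring
      _ ≤ 3 * (b + a) ^ 2 * (2 * b) * a ^ 3 := by gcongr
      _ = _ := by ring
  rw [h1, abs_of_nonneg (by positivity)]
  calc (b - a) ^ 2 * ((b + 2 * a) / (2 * b * a ^ 3))
      ≤ (b - a) ^ 2 * (3 * (b + a) ^ 2 / a ^ 5) := by gcongr
    _ = _ := by field_simp; ring

lemma abs_inv_cube_taylor {a b : ℝ} (ha : 0 < a) (hab : a ≤ 2 * b) :
    |b⁻¹ ^ 3 - a⁻¹ ^ 3 + 3 / 2 * (b ^ 2 - a ^ 2) * a⁻¹ ^ 5|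
      ≤ 24 * (b ^ 2 - a ^ 2) ^ 2 * a⁻¹ ^ 7 := by
  have hb : 0 < b := by linarith
  have h1 : b⁻¹ ^ 3 - a⁻¹ ^ 3 + 3 / 2 * (b ^ 2 - a ^ 2) * a⁻¹ ^ 5
      = (b - a) ^ 2 * ((3 * b ^ 3 + 6 * b ^ 2 * a + 4 * b * a ^ 2 + 2 * a ^ 3)
        / (2 * b ^ 3 * a ^ 5)) := by
    field_simp
    ring
  have h2 : (3 * b ^ 3 + 6 * b ^ 2 * a + 4 * b * a ^ 2 + 2 * a ^ 3) / (2 * b ^ 3 * a ^ 5)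
      ≤ 24 * (b + a) ^ 2 / a ^ 7 := by
    rw [div_le_div_iff₀ (by positivity) (by positivity)]
    have e2 : a ^ 2 ≤ 4 * b ^ 2 := by nlinarith
    have e3 : a ^ 3 ≤ 8 * b ^ 3 := by
      calc a ^ 3 ≤ (2 * b) ^ 3 := by gcongr
        _ = _ := by ring
    have e : 3 * b ^ 3 + 6 * b ^ 2 * a + 4 * b * a ^ 2 + 2 * a ^ 3 ≤ 48 * b ^ 3 := by
      have := mul_le_mul_of_nonneg_left hab (sq_nonneg b)
      have := mul_le_mul_of_nonneg_left e2 hb.le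
      nlinarith [pow_pos hb 3]
    have e4 : a ^ 2 ≤ (b + a) ^ 2 := by gcongr; linarith
    calc (3 * b ^ 3 + 6 * b ^ 2 * a + 4 * b * a ^ 2 + 2 * a ^ 3) * a ^ 7
        ≤ 48 * b ^ 3 * (a ^ 2 * a ^ 5) := by
          rw [← pow_add]; gcongr
      _ ≤ 48 * b ^ 3 * ((b + a) ^ 2 * a ^ 5) := by gcongr
      _ = _ := by ring
  rw [h1, abs_of_nonneg (by positivity)]
  calc _ ≤ (b - a) ^ 2 * (24 * (b + a) ^ 2 / a ^ 7) := by gcongr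
    _ = _ := by field_simp; ring

lemma abs_mul_le_mul {a b A B : ℝ} (ha : |a| ≤ A) (hb : |b| ≤ B) : |a * b| ≤ A * B := by
  rw [abs_mul]
  exact mul_le_mul ha hb (abs_nonneg _) ((abs_nonneg _).trans ha)

/-- First order expansion of `b⁻¹` where `b² = a² + p + s` with `p` of first and `s` of second
order in the small parameter `ρ`. -/
lemma abs_inv_expansion {a b ρ p s : ℝ} (ha : 0 < a) (ha2 : a ≤ 2) (hb : 0 ≤ b) (hρ : 0 ≤ ρ)
    (hρa : 8 * ρ ≤ a) (hp : |p| ≤ 4 * ρ * a) (hs0 : 0 ≤ s) (hs : s ≤ ρ ^ 2)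
    (hab : b ^ 2 = a ^ 2 + p + s) :
    |b⁻¹ - a⁻¹ + p / 2 * a⁻¹ ^ 3| ≤ 160 * ρ ^ 2 * a⁻¹ ^ 4 := by
  -- From p ≥ -4ρa ≥ -a²/2 one gets b² ≥ a²/2.
  have hb2 : a ≤ 2 * b := by
    have := (abs_le.mp hp).1
    nlinarith [mul_nonneg hρ ha.le]
  have h := abs_inv_taylor ha hb2
  have hΔ : |b ^ 2 - a ^ 2| ≤ 5 * ρ * a := by
    have h1 := abs_le.mp hp
    rw [hab, abs_le]; constructor <;> nlinarith
  have hΔ2 : (b ^ 2 - a ^ 2) ^ 2 ≤ (5 * ρ * a) ^ 2 := sq_le_sq' (abs_le.mp hΔ).1 (abs_le.mp hΔ).2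
  have hm : 0 < a⁻¹ := by positivity
  have hma : a⁻¹ * a = 1 := inv_mul_cancel₀ ha.ne'
  have e : b⁻¹ - a⁻¹ + p / 2 * a⁻¹ ^ 3
      = (b⁻¹ - a⁻¹ + (b ^ 2 - a ^ 2) / 2 * a⁻¹ ^ 3) + (-(s / 2 * a⁻¹ ^ 3)) := by
    rw [hab]; ring
  -- Boundedness of the domain (a ≤ 2) absorbs the lower order error into ρ² a⁻⁴, the only error
  -- size carried further.
  have e3 : a⁻¹ ^ 3 ≤ 2 * a⁻¹ ^ 4 := by
    calc a⁻¹ ^ 3 = a * a⁻¹ ^ 4 := by field_simp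
      _ ≤ _ := by gcongr
  calc _ ≤ |b⁻¹ - a⁻¹ + (b ^ 2 - a ^ 2) / 2 * a⁻¹ ^ 3| + |-(s / 2 * a⁻¹ ^ 3)| := by
        rw [e]; exact abs_add_le _ _
    _ ≤ 3 * (5 * ρ * a) ^ 2 * a⁻¹ ^ 5 + ρ ^ 2 / 2 * a⁻¹ ^ 3 := by
        rw [abs_neg, abs_of_nonneg (a := s / 2 * a⁻¹ ^ 3) (by positivity)]
        refine add_le_add (h.trans ?_) ?_ <;> gcongr
    _ = 75.5 * ρ ^ 2 * a⁻¹ ^ 3 := by field_simp; ring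
    _ ≤ 75.5 * ρ ^ 2 * (2 * a⁻¹ ^ 4) := by gcongr
    _ ≤ 160 * ρ ^ 2 * a⁻¹ ^ 4 := by nlinarith [mul_nonneg (sq_nonneg ρ) (pow_pos hm 4).le]

/-- First order expansion of `(l + l₁ + l₂) b⁻³` where `b² = a² + p + s`, with `p, l₁` of first and
`s, l₂` of second order in the small parameter `ρ`. -/
lemma abs_mul_inv_cube_expansion {a b ρ p s l l₁ l₂ : ℝ} (ha : 0 < a) (ha2 : a ≤ 2) (hb : 0 ≤ b)
    (hρ : 0 ≤ ρ) (hρa : 8 * ρ ≤ a) (hp : |p| ≤ 4 * ρ * a) (hs0 : 0 ≤ s) (hs : s ≤ ρ ^ 2)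
    (hab : b ^ 2 = a ^ 2 + p + s) (hl : |l| ≤ 2 * a) (hl₁ : |l₁| ≤ 6 * ρ)
    (hl₂ : |l₂| ≤ 2 * ρ ^ 2) :
    |(l + l₁ + l₂) * b⁻¹ ^ 3 - (l + l₁) * a⁻¹ ^ 3 + 3 / 2 * (l * p) * a⁻¹ ^ 5|
      ≤ 3000 * ρ ^ 2 * a⁻¹ ^ 4 := by
  have hb2 : a ≤ 2 * b := by
    have := (abs_le.mp hp).1
    nlinarith [mul_nonneg hρ ha.le]
  have h := abs_inv_cube_taylor ha hb2
  have hΔ : |b ^ 2 - a ^ 2| ≤ 5 * ρ * a := by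
    have h1 := abs_le.mp hp
    rw [hab, abs_le]; constructor <;> nlinarith
  have hΔ2 : (b ^ 2 - a ^ 2) ^ 2 ≤ (5 * ρ * a) ^ 2 := sq_le_sq' (abs_le.mp hΔ).1 (abs_le.mp hΔ).2
  have hm : 0 < a⁻¹ := by positivity
  have e3 : a⁻¹ ^ 3 ≤ 2 * a⁻¹ ^ 4 := by
    calc a⁻¹ ^ 3 = a * a⁻¹ ^ 4 := by field_simp
      _ ≤ _ := by gcongr
  set E := b⁻¹ ^ 3 - a⁻¹ ^ 3 + 3 / 2 * (b ^ 2 - a ^ 2) * a⁻¹ ^ 5 with hE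
  have e : (l + l₁ + l₂) * b⁻¹ ^ 3 - (l + l₁) * a⁻¹ ^ 3 + 3 / 2 * (l * p) * a⁻¹ ^ 5
      = (l + l₁ + l₂) * E + l₂ * a⁻¹ ^ 3 + -((l₁ + l₂) * (b ^ 2 - a ^ 2) * (3 / 2 * a⁻¹ ^ 5))
        + -(l * s * (3 / 2 * a⁻¹ ^ 5)) := by
    rw [hE, hab]; ring
  have hρ1 : ρ ≤ 1 / 4 := by linarith
  have h12 : |l₁ + l₂| ≤ 7 * ρ := (abs_add_le _ _).trans (by nlinarith)
  have hl3 : |l + l₁ + l₂| ≤ 3 * a := by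
    rw [add_assoc]; exact (abs_add_le _ _).trans (by nlinarith)
  have hE' : |E| ≤ 24 * (5 * ρ * a) ^ 2 * a⁻¹ ^ 7 := h.trans (by gcongr)
  have hs' : |s| ≤ ρ ^ 2 := by rwa [abs_of_nonneg hs0]
  have a1 := abs_mul_le_mul hl3 hE'
  have a2 := abs_mul_le_mul hl₂ (abs_of_nonneg (pow_nonneg hm.le 3)).le
  have a5 : |3 / 2 * a⁻¹ ^ 5| ≤ 3 / 2 * a⁻¹ ^ 5 := (abs_of_nonneg (by positivity)).le
  have a3 := abs_mul_le_mul (abs_mul_le_mul h12 hΔ) a5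
  have a4 := abs_mul_le_mul (abs_mul_le_mul hl hs') a5
  rw [e]
  refine (abs_add_le _ _).trans ?_
  rw [abs_neg (l * s * (3 / 2 * a⁻¹ ^ 5))]
  refine (add_le_add_left ((abs_add_le _ _).trans (add_le_add_left (abs_add_le _ _) _)) _).trans ?_
  rw [abs_neg]
  calc _ ≤ 3 * a * (24 * (5 * ρ * a) ^ 2 * a⁻¹ ^ 7) + 2 * ρ ^ 2 * a⁻¹ ^ 3
        + 7 * ρ * (5 * ρ * a) * (3 / 2 * a⁻¹ ^ 5) + 2 * a * ρ ^ 2 * (3 / 2 * a⁻¹ ^ 5) := by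
        gcongr
    _ = (1800 + 105 / 2 + 3) * ρ ^ 2 * a⁻¹ ^ 4 + 2 * ρ ^ 2 * a⁻¹ ^ 3 := by field_simp; ring
    _ ≤ (1800 + 105 / 2 + 3) * ρ ^ 2 * a⁻¹ ^ 4 + 2 * ρ ^ 2 * (2 * a⁻¹ ^ 4) := by gcongr
    _ ≤ _ := by nlinarith [mul_nonneg (sq_nonneg ρ) (pow_pos hm 4).le]

/-! ### The kernel before integration in the angle -/

/-- `|x - y_θ|²` in terms of `c = cos θ`. -/
def sqDir (x y : ℝ × ℝ) (c : ℝ) : ℝ :=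
  x.1 ^ 2 + y.1 ^ 2 - 2 * y.1 * x.1 * c + (x.2 - y.2) ^ 2

/-- `|y_θ|² |x - y_θ^*|²` in terms of `c = cos θ`. -/
def sqIm (x y : ℝ × ℝ) (c : ℝ) : ℝ :=
  1 + (x.1 ^ 2 + x.2 ^ 2) * (y.1 ^ 2 + y.2 ^ 2) - 2 * y.1 * x.1 * c - 2 * x.2 * y.2

/-- The `r̄`-derivative of `r̄ (|x - y_θ|⁻¹ - |y_θ|⁻¹ |x - y_θ^*|⁻¹)`. -/
def greenDr (x y : ℝ × ℝ) (c : ℝ) : ℝ :=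
  (√(sqDir x y c))⁻¹ - (√(sqIm x y c))⁻¹
    - 1 / 2 * (x.1 * (2 * x.1 - 2 * y.1 * c) * (√(sqDir x y c))⁻¹ ^ 3
      - x.1 * (2 * x.1 * (y.1 ^ 2 + y.2 ^ 2) - 2 * y.1 * c) * (√(sqIm x y c))⁻¹ ^ 3)

/-- The `z̄`-derivative of `r̄ (|x - y_θ|⁻¹ - |y_θ|⁻¹ |x - y_θ^*|⁻¹)`. -/
def greenDz (x y : ℝ × ℝ) (c : ℝ) : ℝ :=
  -(1 / 2) * (x.1 * (2 * (x.2 - y.2)) * (√(sqDir x y c))⁻¹ ^ 3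
      - x.1 * (2 * x.2 * (y.1 ^ 2 + y.2 ^ 2) - 2 * y.2) * (√(sqIm x y c))⁻¹ ^ 3)

lemma sqIm_eq (x y : ℝ × ℝ) (c : ℝ) :
    sqIm x y c = sqDir x y c + (1 - (x.1 ^ 2 + x.2 ^ 2)) * (1 - (y.1 ^ 2 + y.2 ^ 2)) := by
  unfold sqIm sqDir; ring

lemma sqDir_le_sqIm {x y : ℝ × ℝ} (hx : x ∈ halfDisc) (hy : y ∈ halfDisc) (c : ℝ) :
    sqDir x y c ≤ sqIm x y c := by
  rw [sqIm_eq]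
  have := mul_nonneg (sub_nonneg.mpr hx.2) (sub_nonneg.mpr hy.2)
  linarith

lemma le_sqDir {x y : ℝ × ℝ} (hx : x ∈ halfDisc) (hy : y ∈ halfDisc) {c : ℝ} (hc : c ≤ 1) :
    (x.1 - y.1) ^ 2 + (x.2 - y.2) ^ 2 ≤ sqDir x y c := by
  have := mul_nonneg (mul_nonneg hx.1 hy.1) (sub_nonneg.mpr hc)
  unfold sqDir; nlinarith

lemma sqDir_le {x y : ℝ × ℝ} (hx : x ∈ halfDisc) (hy : y ∈ halfDisc) {c : ℝ} (hc : |c| ≤ 1) :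
    sqDir x y c ≤ 4 := by
  have h1 := mul_nonneg (mul_nonneg hx.1 hy.1) (by linarith [(abs_le.mp hc).1] : 0 ≤ c + 1)
  have h2 := hx.2
  have h3 := hy.2
  unfold sqDir
  nlinarith [sq_nonneg (x.1 - y.1), sq_nonneg (x.2 + y.2)]

lemma e1_mem_halfDisc : ((1, 0) : ℝ × ℝ) ∈ halfDisc := by
  simp [halfDisc]

lemma sqDir_e1 (y : ℝ × ℝ) (c : ℝ) :
    sqDir (1, 0) y c = 1 + (y.1 ^ 2 + y.2 ^ 2) - 2 * y.1 * c := by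
  simp only [sqDir]; ring

lemma abs_fst_mul_le {y : ℝ × ℝ} (hy : y ∈ halfDisc) {c : ℝ} (hc : |c| ≤ 1) : |y.1 * c| ≤ 1 := by
  have h : |y.1| ≤ 1 := by
    rw [abs_le]; constructor <;> nlinarith [hy.1, hy.2, sq_nonneg y.2]
  simpa using abs_mul_le_mul h hc

lemma sq_mul_le_sq {y : ℝ × ℝ} {c : ℝ} (hc : |c| ≤ 1) :
    (y.1 * c) ^ 2 ≤ y.1 ^ 2 := by
  have hc2 : c ^ 2 ≤ 1 := (sq_le_one_iff_abs_le_one c).mpr hc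
  nlinarith [sq_nonneg y.1]

/-! ### Expansion of the kernels in x about e₁ -/

section Expansion

variable {x y : ℝ × ℝ} {c ρ : ℝ}

/-- With X = 1 - r̄ and Z = z̄, the squared distance is a² + p + (X² + Z²), where p = -X(2 - 2rc) -
2Zz is linear in (X, Z). Both |1 - rc| and |z| are at most a, which gives |p| ≤ 4ρa. The three
estimates treat the direct terms of `greenDr` and `greenDz`. -/
lemma kernel_direct_expansion (hx : x ∈ halfDisc) (hy : y ∈ halfDisc) (hc : |c| ≤ 1) (hρ : 0 ≤ ρ)
    (hxρ : (1 - x.1) ^ 2 + x.2 ^ 2 ≤ ρ ^ 2) (ha : 0 < √(sqDir (1, 0) y c))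
    (hρa : 8 * ρ ≤ √(sqDir (1, 0) y c)) :
    |(√(sqDir x y c))⁻¹ - (√(sqDir (1, 0) y c))⁻¹
        + (-(1 - x.1) * (2 - 2 * y.1 * c) - 2 * x.2 * y.2) / 2 * (√(sqDir (1, 0) y c))⁻¹ ^ 3|
        ≤ 160 * ρ ^ 2 * (√(sqDir (1, 0) y c))⁻¹ ^ 4 ∧
    |x.1 * (2 * x.1 - 2 * y.1 * c) * (√(sqDir x y c))⁻¹ ^ 3
        - (2 - 2 * y.1 * c - (1 - x.1) * (4 - 2 * y.1 * c)) * (√(sqDir (1, 0) y c))⁻¹ ^ 3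
        + 3 / 2 * ((2 - 2 * y.1 * c) * (-(1 - x.1) * (2 - 2 * y.1 * c) - 2 * x.2 * y.2))
          * (√(sqDir (1, 0) y c))⁻¹ ^ 5| ≤ 3000 * ρ ^ 2 * (√(sqDir (1, 0) y c))⁻¹ ^ 4 ∧
    |x.1 * (2 * (x.2 - y.2)) * (√(sqDir x y c))⁻¹ ^ 3
        - (-2 * y.2 + (2 * x.2 + 2 * (1 - x.1) * y.2)) * (√(sqDir (1, 0) y c))⁻¹ ^ 3
        + 3 / 2 * (-2 * y.2 * (-(1 - x.1) * (2 - 2 * y.1 * c) - 2 * x.2 * y.2))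
          * (√(sqDir (1, 0) y c))⁻¹ ^ 5| ≤ 3000 * ρ ^ 2 * (√(sqDir (1, 0) y c))⁻¹ ^ 4 := by
  set a := √(sqDir (1, 0) y c) with ha_def
  have hP0 : 0 ≤ sqDir (1, 0) y c := (Real.sqrt_pos.mp ha).le
  have ha_sq : a ^ 2 = 1 + (y.1 ^ 2 + y.2 ^ 2) - 2 * y.1 * c := by
    rw [ha_def, Real.sq_sqrt hP0, sqDir_e1]
  have ha2 : a ≤ 2 := by
    rw [ha_def, Real.sqrt_le_left (by norm_num)]
    exact (sqDir_le e1_mem_halfDisc hy hc).trans (by norm_num)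
  have hrc := abs_fst_mul_le hy hc
  have hrc2 := sq_mul_le_sq (y := y) hc
  have hX : |1 - x.1| ≤ ρ := abs_le_of_sq_le_sq (by nlinarith [sq_nonneg x.2]) hρ
  have hZ : |x.2| ≤ ρ := abs_le_of_sq_le_sq (by nlinarith [sq_nonneg (1 - x.1)]) hρ
  have hz : |y.2| ≤ a := abs_le_of_sq_le_sq (by nlinarith [sq_nonneg (1 - y.1 * c)]) ha.le
  have h1 : |1 - y.1 * c| ≤ a := abs_le_of_sq_le_sq (by nlinarith [sq_nonneg y.2]) ha.le
  have hz1 : |y.2| ≤ 1 := abs_le_of_sq_le_sq (by nlinarith [hy.2, sq_nonneg y.1]) zero_le_one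
  have hXa := abs_mul_le_mul hX h1
  have hZa := abs_mul_le_mul hZ hz
  have hXz := abs_mul_le_mul hX hz1
  have hXc := abs_mul_le_mul hX hrc
  have hXZ := abs_mul_le_mul hX hZ
  rw [abs_le] at hX hZ hz h1 hXa hZa hXz hXc hXZ hrc
  have hp : |-(1 - x.1) * (2 - 2 * y.1 * c) - 2 * x.2 * y.2| ≤ 4 * ρ * a := by
    rw [abs_le]; constructor <;> nlinarith
  have hs0 : 0 ≤ (1 - x.1) ^ 2 + x.2 ^ 2 := by positivity
  have hab : √(sqDir x y c) ^ 2 = a ^ 2 + (-(1 - x.1) * (2 - 2 * y.1 * c) - 2 * x.2 * y.2)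
      + ((1 - x.1) ^ 2 + x.2 ^ 2) := by
    have h0 : 0 ≤ sqDir x y c := (by positivity : (0:ℝ) ≤ _).trans (le_sqDir hx hy (abs_le.mp hc).2)
    rw [Real.sq_sqrt h0, ha_sq]; unfold sqDir; ring
  refine ⟨abs_inv_expansion ha ha2 (Real.sqrt_nonneg _) hρ hρa hp hs0 hxρ hab, ?_, ?_⟩
  · have := abs_mul_inv_cube_expansion ha ha2 (Real.sqrt_nonneg _) hρ hρa hp hs0 hxρ hab
      (l := 2 - 2 * y.1 * c) (l₁ := - (1 - x.1) * (4 - 2 * y.1 * c)) (l₂ := 2 * (1 - x.1) ^ 2)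
      (by rw [abs_le]; constructor <;> linarith)
      (by rw [abs_le]; constructor <;> nlinarith)
      (by rw [abs_le]; constructor <;> nlinarith [sq_nonneg x.2, sq_nonneg (1 - x.1)])
    convert this using 2
    ring
  · have := abs_mul_inv_cube_expansion ha ha2 (Real.sqrt_nonneg _) hρ hρa hp hs0 hxρ hab
      (l := -2 * y.2) (l₁ := 2 * x.2 + 2 * (1 - x.1) * y.2) (l₂ := -2 * ((1 - x.1) * x.2))
      (by rw [abs_le]; constructor <;> linarith)
      (by rw [abs_le]; constructor <;> linarith)
      (by rw [abs_le]; constructor <;> linarith)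
    convert this using 2
    ring

/-- The base point a is the same as for the direct term, because `sqIm` and `sqDir` agree at e₁.
With q = |y|², the linear term has 2q - 2rc in place of 2 - 2rc, and the quadratic term gains a
factor q ≤ 1. -/
lemma kernel_image_expansion (hx : x ∈ halfDisc) (hy : y ∈ halfDisc) (hc : |c| ≤ 1) (hρ : 0 ≤ ρ)
    (hxρ : (1 - x.1) ^ 2 + x.2 ^ 2 ≤ ρ ^ 2) (ha : 0 < √(sqDir (1, 0) y c))
    (hρa : 8 * ρ ≤ √(sqDir (1, 0) y c)) :
    |(√(sqIm x y c))⁻¹ - (√(sqDir (1, 0) y c))⁻¹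
        + (-(1 - x.1) * (2 * (y.1 ^ 2 + y.2 ^ 2) - 2 * y.1 * c) - 2 * x.2 * y.2) / 2
          * (√(sqDir (1, 0) y c))⁻¹ ^ 3|
        ≤ 160 * ρ ^ 2 * (√(sqDir (1, 0) y c))⁻¹ ^ 4 ∧
    |x.1 * (2 * x.1 * (y.1 ^ 2 + y.2 ^ 2) - 2 * y.1 * c) * (√(sqIm x y c))⁻¹ ^ 3
        - (2 * (y.1 ^ 2 + y.2 ^ 2) - 2 * y.1 * c
          - (1 - x.1) * (4 * (y.1 ^ 2 + y.2 ^ 2) - 2 * y.1 * c)) * (√(sqDir (1, 0) y c))⁻¹ ^ 3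
        + 3 / 2 * ((2 * (y.1 ^ 2 + y.2 ^ 2) - 2 * y.1 * c)
          * (-(1 - x.1) * (2 * (y.1 ^ 2 + y.2 ^ 2) - 2 * y.1 * c) - 2 * x.2 * y.2))
          * (√(sqDir (1, 0) y c))⁻¹ ^ 5| ≤ 3000 * ρ ^ 2 * (√(sqDir (1, 0) y c))⁻¹ ^ 4 ∧
    |x.1 * (2 * x.2 * (y.1 ^ 2 + y.2 ^ 2) - 2 * y.2) * (√(sqIm x y c))⁻¹ ^ 3
        - (-2 * y.2 + (2 * x.2 * (y.1 ^ 2 + y.2 ^ 2) + 2 * (1 - x.1) * y.2))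
          * (√(sqDir (1, 0) y c))⁻¹ ^ 3
        + 3 / 2 * (-2 * y.2 * (-(1 - x.1) * (2 * (y.1 ^ 2 + y.2 ^ 2) - 2 * y.1 * c)
          - 2 * x.2 * y.2)) * (√(sqDir (1, 0) y c))⁻¹ ^ 5|
          ≤ 3000 * ρ ^ 2 * (√(sqDir (1, 0) y c))⁻¹ ^ 4 := by
  set a := √(sqDir (1, 0) y c) with ha_def
  have hP0 : 0 ≤ sqDir (1, 0) y c := (Real.sqrt_pos.mp ha).le
  have ha_sq : a ^ 2 = 1 + (y.1 ^ 2 + y.2 ^ 2) - 2 * y.1 * c := by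
    rw [ha_def, Real.sq_sqrt hP0, sqDir_e1]
  have ha2 : a ≤ 2 := by
    rw [ha_def, Real.sqrt_le_left (by norm_num)]
    exact (sqDir_le e1_mem_halfDisc hy hc).trans (by norm_num)
  have hrc := abs_fst_mul_le hy hc
  have hrc2 := sq_mul_le_sq (y := y) hc
  have hX : |1 - x.1| ≤ ρ := abs_le_of_sq_le_sq (by nlinarith [sq_nonneg x.2]) hρ
  have hZ : |x.2| ≤ ρ := abs_le_of_sq_le_sq (by nlinarith [sq_nonneg (1 - x.1)]) hρ
  have hz : |y.2| ≤ a := abs_le_of_sq_le_sq (by nlinarith [sq_nonneg (1 - y.1 * c)]) ha.le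
  have hz1 : |y.2| ≤ 1 := abs_le_of_sq_le_sq (by nlinarith [hy.2, sq_nonneg y.1]) zero_le_one
  have hz2 := sq_nonneg y.2
  have h0 : 0 ≤ sqIm x y c := ((by positivity : (0:ℝ) ≤ _).trans
      (le_sqDir hx hy (abs_le.mp hc).2)).trans (sqDir_le_sqIm hx hy c)
  have hq1 : y.1 ^ 2 + y.2 ^ 2 ≤ 1 := hy.2
  have hq0 : 0 ≤ y.1 ^ 2 + y.2 ^ 2 := by positivity
  have hsq : √(sqIm x y c) ^ 2 = a ^ 2
      + (-(1 - x.1) * (2 * (y.1 ^ 2 + y.2 ^ 2) - 2 * y.1 * c) - 2 * x.2 * y.2)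
      + (y.1 ^ 2 + y.2 ^ 2) * ((1 - x.1) ^ 2 + x.2 ^ 2) := by
    rw [Real.sq_sqrt h0, ha_sq]; unfold sqIm; ring
  have hq2 : (y.1 * c) ^ 2 ≤ y.1 ^ 2 + y.2 ^ 2 := by linarith
  generalize y.1 ^ 2 + y.2 ^ 2 = q at *
  -- As (rc)² ≤ q, one has (q - rc)² ≤ q(1 + q - 2rc) = q a² ≤ a².
  have h1 : |q - y.1 * c| ≤ a := by
    refine abs_le_of_sq_le_sq ?_ ha.le
    nlinarith [mul_nonneg (sub_nonneg.mpr hq1) (sq_nonneg a)]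
  have hXq : |(1 - x.1) * q| ≤ ρ * 1 := abs_mul_le_mul hX (by rwa [abs_of_nonneg hq0])
  have hZq : |x.2 * q| ≤ ρ * 1 := abs_mul_le_mul hZ (by rwa [abs_of_nonneg hq0])
  have hXa := abs_mul_le_mul hX h1
  have hZa := abs_mul_le_mul hZ hz
  have hXz := abs_mul_le_mul hX hz1
  have hXc := abs_mul_le_mul hX hrc
  have hXZ := abs_mul_le_mul hX hZq
  rw [abs_le] at hX hZ hz h1 hXa hZa hXz hXc hXZ hrc hXq hZq
  have hp : |-(1 - x.1) * (2 * q - 2 * y.1 * c) - 2 * x.2 * y.2| ≤ 4 * ρ * a := by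
    rw [abs_le]; constructor <;> nlinarith
  have hS : 0 ≤ (1 - x.1) ^ 2 + x.2 ^ 2 := by positivity
  have hs0 : 0 ≤ q * ((1 - x.1) ^ 2 + x.2 ^ 2) := by positivity
  have hs : q * ((1 - x.1) ^ 2 + x.2 ^ 2) ≤ ρ ^ 2 :=
    (mul_le_of_le_one_left hS hq1).trans hxρ
  have hX2 : q * (1 - x.1) ^ 2 ≤ ρ ^ 2 :=
    (mul_le_of_le_one_left (sq_nonneg _) hq1).trans (by nlinarith [sq_nonneg x.2])
  have hX2' : 0 ≤ q * (1 - x.1) ^ 2 := by positivity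
  refine ⟨abs_inv_expansion ha ha2 (Real.sqrt_nonneg _) hρ hρa hp hs0 hs hsq, ?_, ?_⟩
  · have := abs_mul_inv_cube_expansion ha ha2 (Real.sqrt_nonneg _) hρ hρa hp hs0 hs hsq
      (l := 2 * q - 2 * y.1 * c) (l₁ := - (1 - x.1) * (4 * q - 2 * y.1 * c))
      (l₂ := 2 * (q * (1 - x.1) ^ 2))
      (by rw [abs_le]; constructor <;> linarith)
      (by rw [abs_le]; constructor <;> linarith)
      (by rw [abs_le]; constructor <;> linarith)
    convert this using 2
    ring
  · have := abs_mul_inv_cube_expansion ha ha2 (Real.sqrt_nonneg _) hρ hρa hp hs0 hs hsq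
      (l := -2 * y.2) (l₁ := 2 * x.2 * q + 2 * (1 - x.1) * y.2)
      (l₂ := -2 * ((1 - x.1) * (x.2 * q)))
      (by rw [abs_le]; constructor <;> linarith)
      (by rw [abs_le]; constructor <;> linarith)
      (by rw [abs_le]; constructor <;> linarith)
    convert this using 2
    ring

lemma halfDisc_neg (hy : y ∈ halfDisc) : ((y.1, -y.2) : ℝ × ℝ) ∈ halfDisc := by
  simpa [halfDisc] using hy

lemma sqDir_e1_neg (y : ℝ × ℝ) (c : ℝ) : sqDir (1, 0) (y.1, -y.2) c = sqDir (1, 0) y c := by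
  simp [sqDir_e1]

/-- All terms even in z drop out of the difference, among them the zeroth order and everything
proportional to 1 - r̄. The odd contributions of the two inverse distances cancel each other. What
is left comes from the cubes, where (2 - 2rc) - (2q - 2rc) = 2(1 - q). The errors add up to 2(160 +
160 + 1500 + 1500) ≤ 7000. -/
lemma greenDr_odd_expansion (hx : x ∈ halfDisc) (hy : y ∈ halfDisc) (hc : |c| ≤ 1) (hρ : 0 ≤ ρ)
    (hxρ : (1 - x.1) ^ 2 + x.2 ^ 2 ≤ ρ ^ 2) (ha : 0 < √(sqDir (1, 0) y c))
    (hρa : 8 * ρ ≤ √(sqDir (1, 0) y c)) :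
    |greenDr x y c - greenDr x (y.1, -y.2) c
        + 6 * y.2 * x.2 * (1 - (y.1 ^ 2 + y.2 ^ 2)) * (√(sqDir (1, 0) y c))⁻¹ ^ 5|
      ≤ 7000 * ρ ^ 2 * (√(sqDir (1, 0) y c))⁻¹ ^ 4 := by
  obtain ⟨A1, A2, -⟩ := kernel_direct_expansion hx hy hc hρ hxρ ha hρa
  obtain ⟨B1, B2, -⟩ := kernel_image_expansion hx hy hc hρ hxρ ha hρa
  rw [← sqDir_e1_neg] at ha hρa
  obtain ⟨C1, C2, -⟩ := kernel_direct_expansion hx (halfDisc_neg hy) hc hρ hxρ ha hρa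
  obtain ⟨D1, D2, -⟩ := kernel_image_expansion hx (halfDisc_neg hy) hc hρ hxρ ha hρa
  rw [sqDir_e1_neg] at C1 C2 D1 D2
  simp only [neg_sq] at C1 C2 D1 D2
  unfold greenDr
  simp only [neg_sq]
  generalize (√(sqDir (1, 0) y c))⁻¹ = m at *
  generalize (√(sqDir x y c))⁻¹ = n₁ at *
  generalize (√(sqIm x y c))⁻¹ = n₂ at *
  generalize (√(sqDir x (y.1, -y.2) c))⁻¹ = n₃ at *
  generalize (√(sqIm x (y.1, -y.2) c))⁻¹ = n₄ at *
  have hm : 0 ≤ ρ ^ 2 * m ^ 4 := by positivity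
  rw [abs_le] at *
  constructor <;> linarith

/-- At zeroth order the direct and image terms cancel. At first order the terms proportional to z̄
are even in z, and the others combine through the difference -2(1 - r̄)(1 - q) of the two linear
terms. -/
lemma greenDz_odd_expansion (hx : x ∈ halfDisc) (hy : y ∈ halfDisc) (hc : |c| ≤ 1) (hρ : 0 ≤ ρ)
    (hxρ : (1 - x.1) ^ 2 + x.2 ^ 2 ≤ ρ ^ 2) (ha : 0 < √(sqDir (1, 0) y c))
    (hρa : 8 * ρ ≤ √(sqDir (1, 0) y c)) :
    |greenDz x y c - greenDz x (y.1, -y.2) c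
        - 6 * y.2 * (1 - x.1) * (1 - (y.1 ^ 2 + y.2 ^ 2)) * (√(sqDir (1, 0) y c))⁻¹ ^ 5|
      ≤ 7000 * ρ ^ 2 * (√(sqDir (1, 0) y c))⁻¹ ^ 4 := by
  obtain ⟨-, -, A3⟩ := kernel_direct_expansion hx hy hc hρ hxρ ha hρa
  obtain ⟨-, -, B3⟩ := kernel_image_expansion hx hy hc hρ hxρ ha hρa
  rw [← sqDir_e1_neg] at ha hρa
  obtain ⟨-, -, C3⟩ := kernel_direct_expansion hx (halfDisc_neg hy) hc hρ hxρ ha hρa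
  obtain ⟨-, -, D3⟩ := kernel_image_expansion hx (halfDisc_neg hy) hc hρ hxρ ha hρa
  rw [sqDir_e1_neg] at C3 D3
  simp only [neg_sq] at C3 D3
  unfold greenDz
  simp only [neg_sq]
  generalize (√(sqDir (1, 0) y c))⁻¹ = m at *
  generalize (√(sqDir x y c))⁻¹ = n₁ at *
  generalize (√(sqIm x y c))⁻¹ = n₂ at *
  generalize (√(sqDir x (y.1, -y.2) c))⁻¹ = n₃ at *
  generalize (√(sqIm x (y.1, -y.2) c))⁻¹ = n₄ at *
  have hm : 0 ≤ ρ ^ 2 * m ^ 4 := by positivity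
  rw [abs_le] at *
  constructor <;> linarith

end Expansion

/-! ### Size of the differentiated kernels -/

section SizeBound

variable {x y : ℝ × ℝ} {c : ℝ}

lemma abs_mul_inv_cube_le {a b l : ℝ} (ha : 0 < a) (hab : a ≤ b) (hl : |l| ≤ 2 * b) :
    |l * b⁻¹ ^ 3| ≤ 2 * a⁻¹ ^ 2 := by
  have hb : 0 < b := ha.trans_le hab
  rw [abs_mul, abs_of_nonneg (a := b⁻¹ ^ 3) (by positivity)]
  calc |l| * b⁻¹ ^ 3 ≤ 2 * b * b⁻¹ ^ 3 := by gcongr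
    _ = 2 * b⁻¹ ^ 2 := by field_simp
    _ ≤ _ := by gcongr

/-- The gradients of `sqDir` and `sqIm` are bounded by twice the square roots. -/
lemma abs_grad_le (hx : x ∈ halfDisc) (hy : y ∈ halfDisc) (hc : |c| ≤ 1) :
    |x.1 * (2 * x.1 - 2 * y.1 * c)| ≤ 2 * √(sqDir x y c) ∧
    |x.1 * (2 * (x.2 - y.2))| ≤ 2 * √(sqDir x y c) ∧
    |x.1 * (2 * x.1 * (y.1 ^ 2 + y.2 ^ 2) - 2 * y.1 * c)| ≤ 2 * √(sqIm x y c) ∧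
    |x.1 * (2 * x.2 * (y.1 ^ 2 + y.2 ^ 2) - 2 * y.2)| ≤ 2 * √(sqIm x y c) := by
  have hx1 : |x.1| ≤ 1 := abs_le_of_sq_le_sq (by nlinarith [hx.2, sq_nonneg x.2]) zero_le_one
  have hc2 := sq_mul_le_sq (y := y) hc
  have key : ∀ {l P : ℝ}, l ^ 2 ≤ P → |x.1 * (2 * l)| ≤ 2 * √P := by
    intro l P h
    have h1 : |2 * l| ≤ 2 * √P := by
      rw [abs_mul, abs_two]
      gcongr
      exact Real.abs_le_sqrt h
    simpa using abs_mul_le_mul hx1 h1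
  have hq1 : y.1 ^ 2 + y.2 ^ 2 ≤ 1 := hy.2
  have hI0 : 0 ≤ sqIm x y c := ((by positivity : (0:ℝ) ≤ _).trans
      (le_sqDir hx hy (abs_le.mp hc).2)).trans (sqDir_le_sqIm hx hy c)
  have hI : (y.1 ^ 2 + y.2 ^ 2) * sqIm x y c ≤ sqIm x y c := mul_le_of_le_one_left hI0 hq1
  -- With q = |y|², the vector qx - y_θ is q(x - y_θ^*), so its squared norm is q times `sqIm`; its
  -- component r sin θ is dropped.
  have hI' : (x.1 * (y.1 ^ 2 + y.2 ^ 2) - y.1 * c) ^ 2 + (x.2 * (y.1 ^ 2 + y.2 ^ 2) - y.2) ^ 2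
      ≤ (y.1 ^ 2 + y.2 ^ 2) * sqIm x y c := by
    unfold sqIm; nlinarith
  refine ⟨?_, ?_, ?_, ?_⟩
  · convert key (l := x.1 - y.1 * c) (P := sqDir x y c) ?_ using 2
    · ring
    · unfold sqDir; nlinarith [sq_nonneg (x.2 - y.2)]
  · refine key ?_
    unfold sqDir; nlinarith [sq_nonneg (x.1 - y.1 * c)]
  · convert key (l := x.1 * (y.1 ^ 2 + y.2 ^ 2) - y.1 * c) (P := sqIm x y c) ?_ using 2
    · ring
    · nlinarith [sq_nonneg (x.2 * (y.1 ^ 2 + y.2 ^ 2) - y.2)]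
  · convert key (l := x.2 * (y.1 ^ 2 + y.2 ^ 2) - y.2) (P := sqIm x y c) ?_ using 2
    · ring
    · nlinarith [sq_nonneg (x.1 * (y.1 ^ 2 + y.2 ^ 2) - y.1 * c)]

lemma abs_greenDr_le (hx : x ∈ halfDisc) (hy : y ∈ halfDisc) (hc : |c| ≤ 1)
    (hP : 0 < sqDir x y c) : |greenDr x y c| ≤ 6 * (sqDir x y c)⁻¹ := by
  obtain ⟨h1, -, h2, -⟩ := abs_grad_le hx hy hc
  have ha : 0 < √(sqDir x y c) := Real.sqrt_pos.mpr hP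
  have hab := Real.sqrt_le_sqrt (sqDir_le_sqIm hx hy c)
  have ha2 : √(sqDir x y c) ≤ 2 := by
    rw [Real.sqrt_le_left (by norm_num)]
    exact (sqDir_le hx hy hc).trans (by norm_num)
  have hs : (√(sqDir x y c))⁻¹ ^ 2 = (sqDir x y c)⁻¹ := by rw [inv_pow, Real.sq_sqrt hP.le]
  have h1 := abs_mul_inv_cube_le ha le_rfl h1
  have h2 := abs_mul_inv_cube_le ha hab h2
  have h3 : (√(sqIm x y c))⁻¹ ≤ (√(sqDir x y c))⁻¹ := by gcongr
  have h4 : 0 ≤ (√(sqIm x y c))⁻¹ := by positivity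
  have h5 : (√(sqDir x y c))⁻¹ ≤ 2 * (√(sqDir x y c))⁻¹ ^ 2 := by
    field_simp; linarith
  rw [← hs]
  unfold greenDr
  rw [abs_le] at *
  constructor <;> linarith

lemma abs_greenDz_le (hx : x ∈ halfDisc) (hy : y ∈ halfDisc) (hc : |c| ≤ 1)
    (hP : 0 < sqDir x y c) : |greenDz x y c| ≤ 6 * (sqDir x y c)⁻¹ := by
  obtain ⟨-, h1, -, h2⟩ := abs_grad_le hx hy hc
  have ha : 0 < √(sqDir x y c) := Real.sqrt_pos.mpr hP
  have hab := Real.sqrt_le_sqrt (sqDir_le_sqIm hx hy c)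
  have hs : (√(sqDir x y c))⁻¹ ^ 2 = (sqDir x y c)⁻¹ := by rw [inv_pow, Real.sq_sqrt hP.le]
  have h1 := abs_mul_inv_cube_le ha le_rfl h1
  have h2 := abs_mul_inv_cube_le ha hab h2
  have h5 : 0 ≤ (√(sqDir x y c))⁻¹ ^ 2 := by positivity
  rw [← hs]
  unfold greenDz
  rw [abs_le] at *
  constructor <;> linarith

end SizeBound

/-! ### Integrals in the angle -/

/-- If r ≥ 1/4 then r r̄ ≥ 1/8, and the angular part 2 r r̄ (1 - cos θ) controls θ². If r ≤ 1/4 then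
|r̄ - r| ≥ 1/4, which alone dominates because θ² ≤ 10. -/
lemma sqDir_cos_lower {x y : ℝ × ℝ} (hx : x ∈ halfDisc) (hy : y ∈ halfDisc) (hx1 : 1 / 2 ≤ x.1)
    {θ : ℝ} (hθ : |θ| ≤ π) :
    ((x.1 - y.1) ^ 2 + (x.2 - y.2) ^ 2 + θ ^ 2) / 400 ≤ sqDir x y (cos θ) := by
  have h1 := le_sqDir hx hy (cos_le_one θ)
  have hπ : θ ^ 2 ≤ 10 := by
    have : θ ^ 2 ≤ π ^ 2 := sq_le_sq' (by linarith [(abs_le.mp hθ).1]) (abs_le.mp hθ).2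
    nlinarith [Real.pi_lt_d2, Real.pi_pos]
  have hcos : θ ^ 2 / 5 ≤ 1 - cos θ := by
    have h := Real.cos_le_one_sub_mul_cos_sq hθ
    have : (1 : ℝ) / 5 ≤ 2 / π ^ 2 := by
      rw [div_le_div_iff₀ (by norm_num) (by positivity)]
      nlinarith [Real.pi_lt_d2, Real.pi_pos]
    nlinarith [mul_le_mul_of_nonneg_right this (sq_nonneg θ)]
  rcases le_total (1 / 4) y.1 with hr | hr
  · have h2 : 1 / 8 ≤ y.1 * x.1 := by nlinarith
    have h3 : sqDir x y (cos θ)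
        = (x.1 - y.1) ^ 2 + (x.2 - y.2) ^ 2 + 2 * (y.1 * x.1) * (1 - cos θ) := by
      unfold sqDir; ring
    have h4 : 2 * (1 / 8) * (θ ^ 2 / 5) ≤ 2 * (y.1 * x.1) * (1 - cos θ) := by gcongr
    rw [h3]
    nlinarith [sq_nonneg (x.1 - y.1), sq_nonneg (x.2 - y.2), sq_nonneg θ]
  · nlinarith [sq_nonneg (x.1 - y.1), sq_nonneg (x.2 - y.2), sq_nonneg θ]

lemma continuous_inv_sq_add_sq {R : ℝ} (hR : 0 < R) :
    Continuous fun θ : ℝ => (R ^ 2 + θ ^ 2)⁻¹ :=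
  Continuous.inv₀ (by fun_prop) fun θ => by positivity

lemma integral_inv_sq_add_sq_le {R : ℝ} (hR : 0 < R) :
    ∫ θ in (-π)..π, (R ^ 2 + θ ^ 2)⁻¹ ≤ π / R := by
  have hd : ∀ θ ∈ uIcc (-π) π,
      HasDerivAt (fun θ => R⁻¹ * arctan (θ / R)) ((R ^ 2 + θ ^ 2)⁻¹) θ := by
    intro θ _
    have h := ((hasDerivAt_arctan (θ / R)).comp θ ((hasDerivAt_id θ).div_const R)).const_mul R⁻¹
    refine h.congr_deriv ?_
    field_simp
  rw [intervalIntegral.integral_eq_sub_of_hasDerivAt hd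
    ((continuous_inv_sq_add_sq hR).intervalIntegrable _ _)]
  have h1 := (arctan_lt_pi_div_two (π / R)).le
  have h2 := (neg_pi_div_two_lt_arctan (-π / R)).le
  calc R⁻¹ * arctan (π / R) - R⁻¹ * arctan (-π / R)
      = R⁻¹ * (arctan (π / R) - arctan (-π / R)) := by ring
    _ ≤ R⁻¹ * π := by gcongr; linarith
    _ = π / R := by ring

/-- A bound for the integral of a function dominated by a multiple of `(R² + θ²)⁻¹`. -/
lemma abs_integral_le_of_le_inv {R M : ℝ} {f : ℝ → ℝ} (hR : 0 < R)
    (hf : ∀ θ, |θ| ≤ π → |f θ| ≤ M * (R ^ 2 + θ ^ 2)⁻¹) :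
    |∫ θ in (-π)..π, f θ| ≤ M * (π / R) := by
  have hM : 0 ≤ M := by
    have h := (abs_nonneg _).trans (hf 0 (by simpa using pi_pos.le))
    have : 0 < (R ^ 2 + (0 : ℝ) ^ 2)⁻¹ := by positivity
    exact nonneg_of_mul_nonneg_left h this
  have h := intervalIntegral.norm_integral_le_of_norm_le (f := f) (μ := volume)
    (g := fun θ => M * (R ^ 2 + θ ^ 2)⁻¹) (by linarith [pi_pos] : -π ≤ π)
    (Filter.Eventually.of_forall fun θ hθ => hf θ (abs_le.mpr ⟨hθ.1.le, hθ.2⟩))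
    (((continuous_inv_sq_add_sq hR).const_mul M).intervalIntegrable _ _)
  rw [intervalIntegral.integral_const_mul] at h
  exact h.trans (mul_le_mul_of_nonneg_left (integral_inv_sq_add_sq_le hR) hM)

lemma continuous_inv_sqrt_pow {R : ℝ} (hR : 0 < R) (n : ℕ) :
    Continuous fun θ : ℝ => (√(R ^ 2 + θ ^ 2))⁻¹ ^ n :=
  (Continuous.inv₀ (by fun_prop) fun θ => by positivity).pow n

/-- With s = θ/√(R² + θ²), an antiderivative is R⁻⁴(s - s³/3). Over the whole line s runs from -1 to
1, which gives 4/3. Since s - s³/3 is stationary at s = 1 and 1 - s = O(R²), truncation at ±π costs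
only a bounded amount. -/
lemma abs_integral_inv_sqrt_pow_five_sub_le {R : ℝ} (hR : 0 < R) (hR2 : R ≤ 2) :
    |(∫ θ in (-π)..π, (√(R ^ 2 + θ ^ 2))⁻¹ ^ 5) - 4 / 3 * R⁻¹ ^ 4| ≤ 8 * R⁻¹ ^ 3 := by
  have hd : ∀ θ ∈ uIcc (-π) π,
      HasDerivAt (fun θ => R⁻¹ ^ 4 * (θ / √(R ^ 2 + θ ^ 2) - (θ / √(R ^ 2 + θ ^ 2)) ^ 3 / 3))
        ((√(R ^ 2 + θ ^ 2))⁻¹ ^ 5) θ := by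
    intro θ _
    have hq : 0 < R ^ 2 + θ ^ 2 := by positivity
    have hs : 0 < √(R ^ 2 + θ ^ 2) := Real.sqrt_pos.mpr hq
    have h1 : HasDerivAt (fun θ : ℝ => √(R ^ 2 + θ ^ 2)) (2 * θ / (2 * √(R ^ 2 + θ ^ 2))) θ := by
      have := ((hasDerivAt_pow 2 θ).const_add (R ^ 2)).sqrt hq.ne'
      simpa using this
    have h2 := (hasDerivAt_id θ).div h1 hs.ne'
    have h3 := (h2.sub ((h2.pow 3).div_const 3)).const_mul (R⁻¹ ^ 4)
    refine h3.congr_deriv ?_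
    have e : √(R ^ 2 + θ ^ 2) ^ 2 = R ^ 2 + θ ^ 2 := Real.sq_sqrt hq.le
    simp only [id, Pi.div_apply, Nat.cast_ofNat, show 3 - 1 = 2 from rfl]
    generalize √(R ^ 2 + θ ^ 2) = s at *
    have eR : θ ^ 2 = s ^ 2 - R ^ 2 := by linarith
    field_simp
    have : (s ^ 2 - θ ^ 2) * (s ^ 2 - θ ^ 2) = R ^ 4 := by rw [eR]; ring
    linear_combination this
  rw [intervalIntegral.integral_eq_sub_of_hasDerivAt hd
    ((continuous_inv_sqrt_pow hR 5).intervalIntegrable _ _)]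
  have hq : 0 < R ^ 2 + π ^ 2 := by positivity
  have hs : 0 < √(R ^ 2 + π ^ 2) := Real.sqrt_pos.mpr hq
  have e : √(R ^ 2 + π ^ 2) ^ 2 = R ^ 2 + π ^ 2 := Real.sq_sqrt hq.le
  have hneg : (-π) / √(R ^ 2 + π ^ 2) = -(π / √(R ^ 2 + π ^ 2)) := by ring
  rw [neg_sq, hneg]
  set s := π / √(R ^ 2 + π ^ 2) with hs_def
  have hs0 : 0 ≤ s := by positivity
  have hs1 : s ≤ 1 := by
    rw [hs_def, div_le_one hs]; exact Real.le_sqrt_of_sq_le (by nlinarith [sq_nonneg R])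
  have hs2 : 1 - s ^ 2 ≤ R ^ 2 / 9 := by
    have : 1 - s ^ 2 = R ^ 2 / (R ^ 2 + π ^ 2) := by
      rw [hs_def, div_pow, e]; field_simp; ring
    rw [this]
    gcongr
    nlinarith [Real.pi_gt_three, sq_nonneg R]
  have h1s : 0 ≤ 1 - s := by linarith
  have h1s' : 1 - s ≤ R ^ 2 / 9 := by nlinarith
  have key : |2 * (s - s ^ 3 / 3) - 4 / 3| ≤ R ^ 4 := by
    have h : 2 * (s - s ^ 3 / 3) - 4 / 3 = -((2 / 3) * (s + 2) * (1 - s) ^ 2) := by ring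
    rw [h, abs_neg, abs_of_nonneg (by positivity)]
    calc (2 / 3) * (s + 2) * (1 - s) ^ 2 ≤ 2 / 3 * (1 + 2) * (R ^ 2 / 9) ^ 2 := by gcongr
      _ ≤ R ^ 4 := by nlinarith [pow_pos hR 4]
  have h2 : R⁻¹ ^ 4 * (s - s ^ 3 / 3) - R⁻¹ ^ 4 * (-s - (-s) ^ 3 / 3) - 4 / 3 * R⁻¹ ^ 4
      = R⁻¹ ^ 4 * (2 * (s - s ^ 3 / 3) - 4 / 3) := by ring
  rw [h2, abs_mul, abs_of_nonneg (by positivity : (0:ℝ) ≤ R⁻¹ ^ 4)]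
  calc R⁻¹ ^ 4 * |2 * (s - s ^ 3 / 3) - 4 / 3| ≤ R⁻¹ ^ 4 * R ^ 4 := by gcongr
    _ = R ^ 3 * R⁻¹ ^ 3 := by field_simp
    _ ≤ 2 ^ 3 * R⁻¹ ^ 3 := by gcongr
    _ = 8 * R⁻¹ ^ 3 := by norm_num

lemma abs_two_mul_one_sub_cos_sub_sq_le (θ : ℝ) : |2 * (1 - cos θ) - θ ^ 2| ≤ θ ^ 4 := by
  have h0 := one_sub_sq_div_two_le_cos (x := θ)
  have h1 := cos_le_one θ
  rcases le_total |θ| 1 with h | h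
  · have hb := abs_le.mp (Real.cos_bound h)
    have e : |θ| ^ 4 = θ ^ 4 := by rw [← abs_pow, abs_of_nonneg (by positivity)]
    rw [e] at hb
    have : 0 ≤ θ ^ 4 := by positivity
    rw [abs_le]; constructor <;> linarith
  · have h2 : 1 ≤ θ ^ 2 := by rwa [one_le_sq_iff_one_le_abs]
    rw [abs_le]; constructor <;> nlinarith

/-- Used to replace the true distance by √(R² + θ²); the ratio 20 is the square root of the constant
400 in `sqDir_cos_lower`. -/
lemma abs_inv_pow_five_sub_le {a q : ℝ} (ha : 0 < a) (hq : 0 < q) (h : q ≤ 20 * a) :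
    |a⁻¹ ^ 5 - q⁻¹ ^ 5| ≤ 16000000 * |a ^ 2 - q ^ 2| * q⁻¹ ^ 7 := by
  have hα : 0 < a⁻¹ := by positivity
  have hβ : 0 < q⁻¹ := by positivity
  have hαβ : a⁻¹ ≤ 20 * q⁻¹ := by
    rw [← div_eq_mul_inv, ← one_div, div_le_div_iff₀ ha hq]; linarith
  have h1 : |a⁻¹ - q⁻¹| ≤ |a ^ 2 - q ^ 2| * (20 * q⁻¹ ^ 3) := by
    have e : a⁻¹ - q⁻¹ = -((a ^ 2 - q ^ 2) * ((a + q)⁻¹ * a⁻¹ * q⁻¹)) := by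
      field_simp; ring
    rw [e, abs_neg, abs_mul, abs_of_nonneg (a := (a + q)⁻¹ * a⁻¹ * q⁻¹) (by positivity)]
    have : (a + q)⁻¹ ≤ q⁻¹ := by gcongr; linarith
    calc _ ≤ |a ^ 2 - q ^ 2| * (q⁻¹ * (20 * q⁻¹) * q⁻¹) := by gcongr
      _ = _ := by ring
  have e : a⁻¹ ^ 5 - q⁻¹ ^ 5 = (a⁻¹ - q⁻¹) * (a⁻¹ ^ 4 + a⁻¹ ^ 3 * q⁻¹ + a⁻¹ ^ 2 * q⁻¹ ^ 2
      + a⁻¹ * q⁻¹ ^ 3 + q⁻¹ ^ 4) := by ring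
  rw [e, abs_mul, abs_of_nonneg (a := a⁻¹ ^ 4 + a⁻¹ ^ 3 * q⁻¹ + a⁻¹ ^ 2 * q⁻¹ ^ 2
      + a⁻¹ * q⁻¹ ^ 3 + q⁻¹ ^ 4) (by positivity)]
  calc _ ≤ |a ^ 2 - q ^ 2| * (20 * q⁻¹ ^ 3) * ((20 * q⁻¹) ^ 4 + (20 * q⁻¹) ^ 3 * q⁻¹
        + (20 * q⁻¹) ^ 2 * q⁻¹ ^ 2 + (20 * q⁻¹) * q⁻¹ ^ 3 + q⁻¹ ^ 4) := by gcongr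
    _ = 3368420 * (|a ^ 2 - q ^ 2| * q⁻¹ ^ 7) := by ring
    _ ≤ 16000000 * (|a ^ 2 - q ^ 2| * q⁻¹ ^ 7) := by gcongr; norm_num
    _ = _ := by ring

/-! ### Angular integrals based at e₁ -/

section AtE1

variable {y : ℝ × ℝ} {R : ℝ}

lemma sqDir_e1_lower (hy : y ∈ halfDisc) (hR2 : R ^ 2 = (1 - y.1) ^ 2 + y.2 ^ 2) {θ : ℝ}
    (hθ : |θ| ≤ π) : (R ^ 2 + θ ^ 2) / 400 ≤ sqDir (1, 0) y (cos θ) := by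
  have := sqDir_cos_lower e1_mem_halfDisc hy (by norm_num) hθ
  simp only [zero_sub, neg_sq] at this
  rwa [hR2]

lemma sqDir_e1_eq (hR2 : R ^ 2 = (1 - y.1) ^ 2 + y.2 ^ 2) (c : ℝ) :
    sqDir (1, 0) y c = R ^ 2 + 2 * y.1 * (1 - c) := by
  rw [sqDir_e1, hR2]; ring

lemma sqrt_le_mul_sqrt_sqDir_e1 (hy : y ∈ halfDisc) (hR2 : R ^ 2 = (1 - y.1) ^ 2 + y.2 ^ 2) {θ : ℝ}
    (hθ : |θ| ≤ π) : √(R ^ 2 + θ ^ 2) ≤ 20 * √(sqDir (1, 0) y (cos θ)) := by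
  have := Real.sqrt_le_sqrt (sqDir_e1_lower hy hR2 hθ)
  rw [Real.sqrt_div' _ (by norm_num), show (400 : ℝ) = 20 ^ 2 by norm_num,
    Real.sqrt_sq (by norm_num)] at this
  linarith

lemma dist_le_two (hy : y ∈ halfDisc) (hR2 : R ^ 2 = (1 - y.1) ^ 2 + y.2 ^ 2) : R ≤ 2 := by
  have := hy.1
  have := hy.2
  exact le_of_sq_le_sq (by nlinarith) (by norm_num)

lemma le_sqrt_sqDir_e1 (hy : y ∈ halfDisc) (hR2 : R ^ 2 = (1 - y.1) ^ 2 + y.2 ^ 2) {c : ℝ}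
    (hc : c ≤ 1) : R ≤ √(sqDir (1, 0) y c) := by
  refine Real.le_sqrt_of_sq_le ?_
  have := le_sqDir e1_mem_halfDisc hy hc
  simp only [zero_sub, neg_sq] at this
  rwa [hR2]

lemma continuous_inv_sqrt_sqDir_e1 (hy : y ∈ halfDisc) (hR : 0 < R)
    (hR2 : R ^ 2 = (1 - y.1) ^ 2 + y.2 ^ 2) :
    Continuous fun θ : ℝ => (√(sqDir (1, 0) y (cos θ)))⁻¹ := by
  refine Continuous.inv₀ (by unfold sqDir; fun_prop) fun θ => ?_
  exact (hR.trans_le (le_sqrt_sqDir_e1 hy hR2 (cos_le_one θ))).ne'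

/-- Two of the four powers are spent on R⁻², so that the remaining factor has angular integral at
most π/R. -/
lemma inv_sqrt_sqDir_e1_pow_four_le (hy : y ∈ halfDisc) (hR : 0 < R)
    (hR2 : R ^ 2 = (1 - y.1) ^ 2 + y.2 ^ 2) {θ : ℝ} (hθ : |θ| ≤ π) :
    (√(sqDir (1, 0) y (cos θ)))⁻¹ ^ 4 ≤ 160000 * R⁻¹ ^ 2 * (R ^ 2 + θ ^ 2)⁻¹ := by
  have h1 := sqrt_le_mul_sqrt_sqDir_e1 hy hR2 hθ
  have hq : 0 < √(R ^ 2 + θ ^ 2) := Real.sqrt_pos.mpr (by positivity)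
  have ha : 0 < √(sqDir (1, 0) y (cos θ)) := by linarith
  have h2 : (√(sqDir (1, 0) y (cos θ)))⁻¹ ≤ 20 * (√(R ^ 2 + θ ^ 2))⁻¹ := by
    rw [← div_eq_mul_inv, ← one_div, div_le_div_iff₀ ha hq]; linarith
  have h3 : (√(R ^ 2 + θ ^ 2))⁻¹ ≤ R⁻¹ := by
    gcongr; exact Real.le_sqrt_of_sq_le (by nlinarith [sq_nonneg θ])
  calc (√(sqDir (1, 0) y (cos θ)))⁻¹ ^ 4 ≤ (20 * (√(R ^ 2 + θ ^ 2))⁻¹) ^ 4 := by gcongr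
    _ = 160000 * (√(R ^ 2 + θ ^ 2))⁻¹ ^ 2 * (√(R ^ 2 + θ ^ 2))⁻¹ ^ 2 := by ring
    _ ≤ 160000 * R⁻¹ ^ 2 * (√(R ^ 2 + θ ^ 2))⁻¹ ^ 2 := by gcongr
    _ = _ := by rw [inv_pow (√(R ^ 2 + θ ^ 2)), Real.sq_sqrt (by positivity)]

/-- The angular integral of `|e₁ - y_θ|⁻⁵` is `4/3 |e₁ - y|⁻⁴` up to a lower order term. -/
lemma abs_integral_cos_mul_inv_pow_five_sub_le (hy : y ∈ halfDisc) (hR : 0 < R)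
    (hR2 : R ^ 2 = (1 - y.1) ^ 2 + y.2 ^ 2) :
    |(∫ θ in (-π)..π, cos θ * (√(sqDir (1, 0) y (cos θ)))⁻¹ ^ 5) - 4 / 3 * R⁻¹ ^ 4|
      ≤ 200000000 * R⁻¹ ^ 3 := by
  have hRle := dist_le_two hy hR2
  have hpt : ∀ θ, |θ| ≤ π → |cos θ * (√(sqDir (1, 0) y (cos θ)))⁻¹ ^ 5
      - (√(R ^ 2 + θ ^ 2))⁻¹ ^ 5| ≤ 60000000 * R⁻¹ ^ 2 * (R ^ 2 + θ ^ 2)⁻¹ := by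
    intro θ hθ
    have h1 := sqrt_le_mul_sqrt_sqDir_e1 hy hR2 hθ
    have hq0 : 0 < R ^ 2 + θ ^ 2 := by positivity
    have hq : 0 < √(R ^ 2 + θ ^ 2) := Real.sqrt_pos.mpr hq0
    have ha : 0 < √(sqDir (1, 0) y (cos θ)) := by linarith
    have hqsq : √(R ^ 2 + θ ^ 2) ^ 2 = R ^ 2 + θ ^ 2 := Real.sq_sqrt hq0.le
    have hasq : √(sqDir (1, 0) y (cos θ)) ^ 2 = R ^ 2 + 2 * y.1 * (1 - cos θ) := by
      rw [Real.sq_sqrt (Real.sqrt_pos.mp ha).le, sqDir_e1_eq hR2]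
    have hRq : R ≤ √(R ^ 2 + θ ^ 2) := Real.le_sqrt_of_sq_le (by nlinarith [sq_nonneg θ])
    have hcos : |cos θ - 1| ≤ √(R ^ 2 + θ ^ 2) ^ 2 / 2 := by
      have := one_sub_sq_div_two_le_cos (x := θ)
      have := cos_le_one θ
      rw [hqsq, abs_le]; constructor <;> nlinarith [sq_nonneg R, sq_nonneg θ]
    -- The difference of squares is (r - 1)·2(1 - cos θ) plus 2(1 - cos θ) - θ²; the first is at
    -- most R(R² + θ²), the second at most θ⁴.
    have hdiff : |√(sqDir (1, 0) y (cos θ)) ^ 2 - √(R ^ 2 + θ ^ 2) ^ 2|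
        ≤ R * √(R ^ 2 + θ ^ 2) ^ 2 + √(R ^ 2 + θ ^ 2) ^ 4 := by
      have e : √(R ^ 2 + θ ^ 2) ^ 4 = (R ^ 2 + θ ^ 2) ^ 2 := by
        rw [show (4 : ℕ) = 2 * 2 from rfl, pow_mul, hqsq]
      rw [e, hasq, hqsq]
      have h2 := abs_two_mul_one_sub_cos_sub_sq_le θ
      have hr : |y.1 - 1| ≤ R := abs_le_of_sq_le_sq (by nlinarith [sq_nonneg y.2]) hR.le
      have h3 : |2 * (1 - cos θ)| ≤ R ^ 2 + θ ^ 2 := by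
        have := one_sub_sq_div_two_le_cos (x := θ)
        have := cos_le_one θ
        rw [abs_le]; constructor <;> nlinarith [sq_nonneg R, sq_nonneg θ]
      have h4 := abs_mul_le_mul hr h3
      have e2 : R ^ 2 + 2 * y.1 * (1 - cos θ) - (R ^ 2 + θ ^ 2)
          = (y.1 - 1) * (2 * (1 - cos θ)) + (2 * (1 - cos θ) - θ ^ 2) := by ring
      rw [e2]
      refine (abs_add_le _ _).trans (add_le_add h4 (h2.trans ?_))
      nlinarith [mul_nonneg (sq_nonneg R) (sq_nonneg θ), sq_nonneg (R ^ 2)]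
    have h5 := abs_inv_pow_five_sub_le ha hq h1
    have h6 : (√(sqDir (1, 0) y (cos θ)))⁻¹ ≤ 20 * (√(R ^ 2 + θ ^ 2))⁻¹ := by
      rw [← div_eq_mul_inv, ← one_div, div_le_div_iff₀ ha hq]; linarith
    have hinv : (R ^ 2 + θ ^ 2)⁻¹ = (√(R ^ 2 + θ ^ 2))⁻¹ ^ 2 := by rw [inv_pow, hqsq]
    have e : ∀ c a b : ℝ, c * a ^ 5 - b ^ 5 = (c - 1) * a ^ 5 + (a ^ 5 - b ^ 5) := by
      intros; ring
    rw [hinv, e]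
    set q := √(R ^ 2 + θ ^ 2)
    set a := √(sqDir (1, 0) y (cos θ))
    have hβR : q⁻¹ ≤ R⁻¹ := by gcongr
    have h2R : q⁻¹ ≤ 2 * R⁻¹ ^ 2 := by
      refine hβR.trans ?_
      field_simp; linarith
    have hβ : 0 < q⁻¹ := by positivity
    calc _ ≤ |(cos θ - 1) * a⁻¹ ^ 5| + |a⁻¹ ^ 5 - q⁻¹ ^ 5| := abs_add_le _ _
      _ ≤ q ^ 2 / 2 * (20 * q⁻¹) ^ 5 + 16000000 * (R * q ^ 2 + q ^ 4) * q⁻¹ ^ 7 := by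
          refine add_le_add (abs_mul_le_mul hcos ?_) (h5.trans (by gcongr))
          rw [abs_of_nonneg (by positivity)]
          gcongr
      _ = (17600000 * q⁻¹ + 16000000 * R * (q⁻¹ * q⁻¹ * q⁻¹)) * q⁻¹ ^ 2 := by
          field_simp; ring
      _ ≤ (17600000 * (2 * R⁻¹ ^ 2) + 16000000 * R * (R⁻¹ * R⁻¹ * R⁻¹)) * q⁻¹ ^ 2 := by
          gcongr
      _ = 51200000 * R⁻¹ ^ 2 * q⁻¹ ^ 2 := by field_simp; ring
      _ ≤ 60000000 * R⁻¹ ^ 2 * q⁻¹ ^ 2 := by gcongr; norm_num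
  have hcont := continuous_inv_sqrt_sqDir_e1 hy hR hR2
  have hsub : (∫ θ in (-π)..π, cos θ * (√(sqDir (1, 0) y (cos θ)))⁻¹ ^ 5)
      - ∫ θ in (-π)..π, (√(R ^ 2 + θ ^ 2))⁻¹ ^ 5
      = ∫ θ in (-π)..π, (cos θ * (√(sqDir (1, 0) y (cos θ)))⁻¹ ^ 5
        - (√(R ^ 2 + θ ^ 2))⁻¹ ^ 5) :=
    (intervalIntegral.integral_sub ((continuous_cos.mul (hcont.pow 5)).intervalIntegrable _ _)
      ((continuous_inv_sqrt_pow hR 5).intervalIntegrable _ _)).symm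
  have h1 := abs_integral_le_of_le_inv hR hpt
  have h2 := abs_integral_inv_sqrt_pow_five_sub_le hR hRle
  rw [← hsub] at h1
  have h3 := (abs_sub_le _ _ _).trans (add_le_add h1 h2)
  refine h3.trans ?_
  have hm : 0 < R⁻¹ ^ 3 := by positivity
  calc 60000000 * R⁻¹ ^ 2 * (π / R) + 8 * R⁻¹ ^ 3 = (60000000 * π + 8) * R⁻¹ ^ 3 := by
        field_simp
    _ ≤ _ := by gcongr; linarith [Real.pi_lt_d2]

end AtE1

/-! ### The derivatives of the axisymmetric Green's function -/

open Filter Topology in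
/-- Differentiation under the integral sign for `∫ a(s, θ) (p(s, θ)^{-1/2} - q(s, θ)^{-1/2}) dθ`. -/
lemma hasDerivAt_integral_mul_inv_sqrt_sub {a a' p p' q q' : ℝ → ℝ → ℝ} {s₀ α β : ℝ}
    (ha : Continuous (Function.uncurry a)) (ha' : Continuous (Function.uncurry a'))
    (hp : Continuous (Function.uncurry p)) (hp' : Continuous (Function.uncurry p'))
    (hq : Continuous (Function.uncurry q)) (hq' : Continuous (Function.uncurry q'))
    (hda : ∀ s θ, HasDerivAt (fun s => a s θ) (a' s θ) s)
    (hdp : ∀ s θ, HasDerivAt (fun s => p s θ) (p' s θ) s)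
    (hdq : ∀ s θ, HasDerivAt (fun s => q s θ) (q' s θ) s)
    (hppos : ∀ θ, 0 < p s₀ θ) (hqpos : ∀ θ, 0 < q s₀ θ) :
    HasDerivAt (fun s => ∫ θ in α..β, a s θ * ((√(p s θ))⁻¹ - (√(q s θ))⁻¹))
      (∫ θ in α..β, (a' s₀ θ * ((√(p s₀ θ))⁻¹ - (√(q s₀ θ))⁻¹)
        - a s₀ θ / 2 * (p' s₀ θ * (√(p s₀ θ))⁻¹ ^ 3 - q' s₀ θ * (√(q s₀ θ))⁻¹ ^ 3))) s₀ := by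
  -- Positivity is assumed only at s₀; compactness of the angle interval spreads it to a
  -- neighbourhood of s₀ uniformly in θ.
  have hev : ∀ᶠ s in 𝓝 s₀, ∀ θ ∈ uIcc α β, 0 < p s θ ∧ 0 < q s θ := by
    refine isCompact_uIcc.eventually_forall_of_forall_eventually fun θ _ => ?_
    exact (hp.continuousAt.eventually (lt_mem_nhds (hppos θ))).and
      (hq.continuousAt.eventually (lt_mem_nhds (hqpos θ)))
  obtain ⟨ε, hε, hball⟩ := Metric.eventually_nhds_iff_ball.mp hev
  have hd1 : ∀ {p p' : ℝ → ℝ → ℝ} {s θ}, HasDerivAt (fun s => p s θ) (p' s θ) s → 0 < p s θ →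
      HasDerivAt (fun s => (√(p s θ))⁻¹) (-(p' s θ / 2 * (√(p s θ))⁻¹ ^ 3)) s := by
    intro p p' s θ hd h
    have hs := Real.sqrt_pos.mpr h
    refine ((hd.sqrt h.ne').inv hs.ne').congr_deriv ?_
    field_simp
  have hdF : ∀ s θ, 0 < p s θ → 0 < q s θ →
      HasDerivAt (fun s => a s θ * ((√(p s θ))⁻¹ - (√(q s θ))⁻¹))
      (a' s θ * ((√(p s θ))⁻¹ - (√(q s θ))⁻¹)
        - a s θ / 2 * (p' s θ * (√(p s θ))⁻¹ ^ 3 - q' s θ * (√(q s θ))⁻¹ ^ 3)) s := by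
    intro s θ h1 h2
    refine ((hda s θ).mul ((hd1 (hdp s θ) h1).sub (hd1 (hdq s θ) h2))).congr_deriv ?_
    simp only [Pi.sub_apply]
    ring
  have hcont : ∀ {p : ℝ → ℝ → ℝ} {S : Set ℝ}, Continuous (Function.uncurry p) →
      (∀ s ∈ S, ∀ θ ∈ uIcc α β, 0 < p s θ) →
      ContinuousOn (fun z : ℝ × ℝ => (√(p z.1 z.2))⁻¹) (S ×ˢ uIcc α β) := by
    intro p S hp hS
    refine ContinuousOn.inv₀ (Continuous.continuousOn (hp.sqrt)) fun z hz => ?_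
    exact (Real.sqrt_pos.mpr (hS _ hz.1 _ hz.2)).ne'
  have hF' : ∀ S : Set ℝ, S ⊆ Metric.ball s₀ ε →
      ContinuousOn (fun z : ℝ × ℝ => a' z.1 z.2 * ((√(p z.1 z.2))⁻¹ - (√(q z.1 z.2))⁻¹)
        - a z.1 z.2 / 2 * (p' z.1 z.2 * (√(p z.1 z.2))⁻¹ ^ 3
          - q' z.1 z.2 * (√(q z.1 z.2))⁻¹ ^ 3)) (S ×ˢ uIcc α β) := by
    intro S hS
    have h1 := hcont hp fun s hs θ hθ => (hball s (hS hs) θ hθ).1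
    have h2 := hcont hq fun s hs θ hθ => (hball s (hS hs) θ hθ).2
    exact (ha'.continuousOn.mul (h1.sub h2)).sub ((ha.div_const 2).continuousOn.mul
      ((hp'.continuousOn.mul (h1.pow 3)).sub (hq'.continuousOn.mul (h2.pow 3))))
  have hFs : ∀ s ∈ Metric.ball s₀ ε,
      ContinuousOn (fun θ => a s θ * ((√(p s θ))⁻¹ - (√(q s θ))⁻¹)) (uIcc α β) := by
    intro s hs
    have h1 := hcont (S := {s}) hp fun t ht θ hθ => ht ▸ (hball s hs θ hθ).1
    have h2 := hcont (S := {s}) hq fun t ht θ hθ => ht ▸ (hball s hs θ hθ).2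
    exact (ha.continuousOn.mul (h1.sub h2)).comp
      (by fun_prop : ContinuousOn (fun θ : ℝ => (s, θ)) (uIcc α β)) (fun θ hθ => ⟨rfl, hθ⟩)
  have hsub : Metric.closedBall s₀ (ε / 2) ⊆ Metric.ball s₀ ε :=
    Metric.closedBall_subset_ball (by linarith)
  have hcompact := (isCompact_closedBall s₀ (ε / 2)).prod (isCompact_uIcc (a := α) (b := β))
  obtain ⟨M, hM⟩ := hcompact.exists_bound_of_continuousOn (hF' _ hsub)
  have hnhds : Metric.ball s₀ (ε / 2) ∈ 𝓝 s₀ := Metric.ball_mem_nhds _ (by linarith)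
  have hsub2 : Metric.ball s₀ (ε / 2) ⊆ Metric.ball s₀ ε := Metric.ball_subset_ball (by linarith)
  have hF0 := (hF' {s₀} (by simpa using hε)).comp
    (by fun_prop : ContinuousOn (fun θ : ℝ => (s₀, θ)) (uIcc α β)) (fun θ hθ => ⟨rfl, hθ⟩)
  refine (intervalIntegral.hasDerivAt_integral_of_dominated_loc_of_deriv_le (bound := fun _ => M)
    (F := fun s θ => a s θ * ((√(p s θ))⁻¹ - (√(q s θ))⁻¹))
    (F' := fun s θ => a' s θ * ((√(p s θ))⁻¹ - (√(q s θ))⁻¹)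
        - a s θ / 2 * (p' s θ * (√(p s θ))⁻¹ ^ 3 - q' s θ * (√(q s θ))⁻¹ ^ 3))
    hnhds ?_ ?_ ?_ ?_ ?_ ?_).2
  · filter_upwards [hnhds] with s hs
    exact ((hFs s (hsub2 hs)).mono uIoc_subset_uIcc).aestronglyMeasurable measurableSet_uIoc
  · exact (hFs s₀ (by simpa using hε)).intervalIntegrable
  · exact (hF0.mono uIoc_subset_uIcc).aestronglyMeasurable measurableSet_uIoc
  · exact Eventually.of_forall fun θ hθ s hs =>
      hM (s, θ) ⟨Metric.ball_subset_closedBall hs, uIoc_subset_uIcc hθ⟩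
  · exact intervalIntegrable_const
  · exact Eventually.of_forall fun θ hθ s hs =>
      have h := hball s (hsub2 hs) θ (uIoc_subset_uIcc hθ)
      hdF s θ h.1 h.2

lemma norm_cyl_sub (x y : ℝ × ℝ) (θ : ℝ) :
    ‖cyl x.1 0 x.2 - cyl y.1 θ y.2‖ = √(sqDir x y (cos θ)) := by
  rw [EuclideanSpace.norm_eq]
  congr 1
  simp only [cyl, Fin.sum_univ_three, Real.norm_eq_abs, sq_abs, sqDir]
  simp
  linear_combination (y.1 ^ 2) * (Real.sin_sq_add_cos_sq θ)

lemma norm_cyl_sq (y : ℝ × ℝ) (θ : ℝ) : ‖cyl y.1 θ y.2‖ ^ 2 = y.1 ^ 2 + y.2 ^ 2 := by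
  rw [EuclideanSpace.norm_sq_eq]
  simp only [cyl, Fin.sum_univ_three, Real.norm_eq_abs, sq_abs]
  simp
  linear_combination (y.1 ^ 2) * (Real.sin_sq_add_cos_sq θ)

lemma norm_cyl_mul_norm_sub {y : ℝ × ℝ} (hy : 0 < y.1 ^ 2 + y.2 ^ 2) (x : ℝ × ℝ) (θ : ℝ) :
    ‖cyl y.1 θ y.2‖ * ‖cyl x.1 0 x.2 - (‖cyl y.1 θ y.2‖ ^ 2)⁻¹ • cyl y.1 θ y.2‖
      = √(sqIm x y (cos θ)) := by
  rw [← Real.sqrt_sq (mul_nonneg (norm_nonneg _) (norm_nonneg _)), mul_pow, norm_cyl_sq]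
  congr 1
  rw [EuclideanSpace.norm_sq_eq]
  simp only [cyl, Fin.sum_univ_three, Real.norm_eq_abs, sq_abs, sqIm]
  simp
  field_simp
  linear_combination (y.1 ^ 2) * (Real.sin_sq_add_cos_sq θ)

lemma greenBall_cyl {y : ℝ × ℝ} (hy : 0 < y.1 ^ 2 + y.2 ^ 2) (x : ℝ × ℝ) (θ : ℝ) :
    greenBall (cyl x.1 0 x.2) (cyl y.1 θ y.2)
      = 1 / (4 * π) * ((√(sqDir x y (cos θ)))⁻¹ - (√(sqIm x y (cos θ)))⁻¹) := by
  unfold greenBall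
  rw [mul_assoc (4 * π) ‖_‖ ‖_‖, norm_cyl_mul_norm_sub hy, norm_cyl_sub, one_div, one_div, one_div,
    mul_inv, mul_inv (4 * π)]
  ring

lemma axisymGreen_eq {y : ℝ × ℝ} (hy : 0 < y.1 ^ 2 + y.2 ^ 2) (x : ℝ × ℝ) :
    axisymGreen x y = ∫ θ in (-π)..π, y.1 * x.1 * cos θ / (4 * π)
      * ((√(sqDir x y (cos θ)))⁻¹ - (√(sqIm x y (cos θ)))⁻¹) := by
  have hper : Function.Periodic (fun θ => y.1 * x.1 * cos θ / (4 * π)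
      * ((√(sqDir x y (cos θ)))⁻¹ - (√(sqIm x y (cos θ)))⁻¹)) (2 * π) := by
    intro θ
    simp only [Real.cos_add_two_pi]
  have h := hper.intervalIntegral_add_eq 0 (-π)
  rw [zero_add, show -π + 2 * π = π by ring] at h
  rw [← h]
  unfold axisymGreen
  congr 1
  ext θ
  rw [greenBall_cyl hy]
  ring

lemma sqDir_pos {x y : ℝ × ℝ} (hx : x ∈ halfDisc) (hy : y ∈ halfDisc) (hxy : x ≠ y) {c : ℝ}
    (hc : c ≤ 1) : 0 < sqDir x y c := by
  refine lt_of_lt_of_le ?_ (le_sqDir hx hy hc)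
  by_contra h
  refine hxy (Prod.ext ?_ ?_) <;> nlinarith [sq_nonneg (x.1 - y.1), sq_nonneg (x.2 - y.2)]

/-- The `r̄`-derivative of `axisymGreen`. -/
def axisymGreenDr (x y : ℝ × ℝ) : ℝ :=
  ∫ θ in (-π)..π, y.1 * cos θ / (4 * π) * greenDr x y (cos θ)

/-- The `z̄`-derivative of `axisymGreen`. -/
def axisymGreenDz (x y : ℝ × ℝ) : ℝ :=
  ∫ θ in (-π)..π, y.1 * cos θ / (4 * π) * greenDz x y (cos θ)

lemma deriv_axisymGreen_fst {x y : ℝ × ℝ} (hx : x ∈ halfDisc) (hy : y ∈ halfDisc) (hxy : x ≠ y)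
    (hy1 : 0 < y.1) : deriv (fun s => axisymGreen (s, x.2) y) x.1 = axisymGreenDr x y := by
  have hq : 0 < y.1 ^ 2 + y.2 ^ 2 := by positivity
  simp_rw [axisymGreen_eq hq]
  have h := hasDerivAt_integral_mul_inv_sqrt_sub (α := -π) (β := π) (s₀ := x.1)
    (a := fun s θ => y.1 * s * cos θ / (4 * π)) (a' := fun s θ => y.1 * cos θ / (4 * π))
    (p := fun s θ => sqDir (s, x.2) y (cos θ)) (p' := fun s θ => 2 * s - 2 * y.1 * cos θ)
    (q := fun s θ => sqIm (s, x.2) y (cos θ))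
    (q' := fun s θ => 2 * s * (y.1 ^ 2 + y.2 ^ 2) - 2 * y.1 * cos θ)
    (by unfold Function.uncurry; fun_prop) (by unfold Function.uncurry; fun_prop)
    (by unfold Function.uncurry sqDir; fun_prop) (by unfold Function.uncurry; fun_prop)
    (by unfold Function.uncurry sqIm; fun_prop) (by unfold Function.uncurry; fun_prop)
    (fun s θ => by
      have := (((hasDerivAt_id s).const_mul y.1).mul_const (cos θ)).div_const (4 * π)
      exact this.congr_deriv (by simp))
    (fun s θ => by
      have := (((hasDerivAt_pow 2 s).add_const (y.1 ^ 2)).sub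
        (((hasDerivAt_id s).const_mul (2 * y.1)).mul_const (cos θ))).add_const ((x.2 - y.2) ^ 2)
      exact this.congr_deriv (by simp))
    (fun s θ => by
      have := (((((hasDerivAt_pow 2 s).add_const (x.2 ^ 2)).mul_const (y.1 ^ 2 + y.2 ^ 2)).const_add
        1).sub (((hasDerivAt_id s).const_mul (2 * y.1)).mul_const (cos θ))).sub_const
          (2 * x.2 * y.2)
      exact this.congr_deriv (by simp))
    (fun θ => sqDir_pos hx hy hxy (cos_le_one θ))
    (fun θ => (sqDir_pos hx hy hxy (cos_le_one θ)).trans_le (sqDir_le_sqIm hx hy _))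
  rw [h.deriv]
  unfold axisymGreenDr greenDr
  congr 1
  ext θ
  ring

lemma deriv_axisymGreen_snd {x y : ℝ × ℝ} (hx : x ∈ halfDisc) (hy : y ∈ halfDisc) (hxy : x ≠ y)
    (hy1 : 0 < y.1) : deriv (fun s => axisymGreen (x.1, s) y) x.2 = axisymGreenDz x y := by
  have hq : 0 < y.1 ^ 2 + y.2 ^ 2 := by positivity
  simp_rw [axisymGreen_eq hq]
  have h := hasDerivAt_integral_mul_inv_sqrt_sub (α := -π) (β := π) (s₀ := x.2)
    (a := fun s θ => y.1 * x.1 * cos θ / (4 * π)) (a' := fun s θ => 0)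
    (p := fun s θ => sqDir (x.1, s) y (cos θ)) (p' := fun s θ => 2 * (s - y.2))
    (q := fun s θ => sqIm (x.1, s) y (cos θ))
    (q' := fun s θ => 2 * s * (y.1 ^ 2 + y.2 ^ 2) - 2 * y.2)
    (by unfold Function.uncurry; fun_prop) (by unfold Function.uncurry; fun_prop)
    (by unfold Function.uncurry sqDir; fun_prop) (by unfold Function.uncurry; fun_prop)
    (by unfold Function.uncurry sqIm; fun_prop) (by unfold Function.uncurry; fun_prop)
    (fun s θ => hasDerivAt_const _ _)
    (fun s θ => by
      have := (((hasDerivAt_id s).sub_const y.2).pow 2).const_add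
        (x.1 ^ 2 + y.1 ^ 2 - 2 * y.1 * x.1 * cos θ)
      exact this.congr_deriv (by simp))
    (fun s θ => by
      have := (((((hasDerivAt_pow 2 s).const_add (x.1 ^ 2)).mul_const (y.1 ^ 2 + y.2 ^ 2)).const_add
        1).sub_const (2 * y.1 * x.1 * cos θ)).sub (((hasDerivAt_id s).const_mul 2).mul_const y.2)
      exact this.congr_deriv (by simp))
    (fun θ => sqDir_pos hx hy hxy (cos_le_one θ))
    (fun θ => (sqDir_pos hx hy hxy (cos_le_one θ)).trans_le (sqDir_le_sqIm hx hy _))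
  rw [h.deriv]
  unfold axisymGreenDz greenDz
  congr 1
  ext θ
  ring

/-- The tangential derivative of `axisymGreen` vanishes on the sphere. -/
lemma axisymGreenDz_mul_eq {x : ℝ × ℝ} (hx : x.1 ^ 2 + x.2 ^ 2 = 1) (y : ℝ × ℝ) :
    x.1 * axisymGreenDz x y = x.2 * axisymGreenDr x y := by
  unfold axisymGreenDz axisymGreenDr
  rw [← intervalIntegral.integral_const_mul, ← intervalIntegral.integral_const_mul]
  congr 1
  ext θ
  -- On the sphere the two distances agree, so the inverse distances cancel and both sides reduce to
  -- -r̄² z̄ (1 - |y|²) times the same inverse cube, before angular weighting.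
  have h : sqIm x y (cos θ) = sqDir x y (cos θ) := by rw [sqIm_eq, hx]; ring
  unfold greenDz greenDr
  rw [h]
  ring

/-! ### Bounds for the velocity kernels -/

section Kernel

variable {x y : ℝ × ℝ} {R ρ : ℝ}

lemma continuous_inv_sqrt_sqDir (hx : x ∈ halfDisc) (hy : y ∈ halfDisc) (hxy : x ≠ y) :
    Continuous fun θ : ℝ => (√(sqDir x y (cos θ)))⁻¹ :=
  Continuous.inv₀ (by unfold sqDir; fun_prop) fun θ =>
    (Real.sqrt_pos.mpr (sqDir_pos hx hy hxy (cos_le_one θ))).ne'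

lemma continuous_inv_sqrt_sqIm (hx : x ∈ halfDisc) (hy : y ∈ halfDisc) (hxy : x ≠ y) :
    Continuous fun θ : ℝ => (√(sqIm x y (cos θ)))⁻¹ :=
  Continuous.inv₀ (by unfold sqIm; fun_prop) fun θ =>
    (Real.sqrt_pos.mpr ((sqDir_pos hx hy hxy (cos_le_one θ)).trans_le
      (sqDir_le_sqIm hx hy _))).ne'

lemma continuous_greenDr (hx : x ∈ halfDisc) (hy : y ∈ halfDisc) (hxy : x ≠ y) :
    Continuous fun θ : ℝ => greenDr x y (cos θ) := by
  have h1 := continuous_inv_sqrt_sqDir hx hy hxy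
  have h2 := continuous_inv_sqrt_sqIm hx hy hxy
  unfold greenDr
  fun_prop

lemma continuous_greenDz (hx : x ∈ halfDisc) (hy : y ∈ halfDisc) (hxy : x ≠ y) :
    Continuous fun θ : ℝ => greenDz x y (cos θ) := by
  have h1 := continuous_inv_sqrt_sqDir hx hy hxy
  have h2 := continuous_inv_sqrt_sqIm hx hy hxy
  unfold greenDz
  fun_prop

lemma abs_fst_mul_cos_div_le (hy : y ∈ halfDisc) (θ : ℝ) :
    |y.1 * cos θ / (4 * π)| ≤ 1 / (4 * π) := by
  rw [abs_div, abs_of_nonneg (by positivity : 0 ≤ 4 * π)]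
  gcongr
  exact abs_fst_mul_le hy (abs_cos_le_one θ)

lemma abs_integral_kernel_le {g : ℝ → ℝ} (hx : x ∈ halfDisc) (hy : y ∈ halfDisc)
    (hx1 : 1 / 2 ≤ x.1) (hR : 0 < R) (hR2 : R ^ 2 = (x.1 - y.1) ^ 2 + (x.2 - y.2) ^ 2)
    (hg : ∀ θ, 0 < sqDir x y (cos θ) → |g θ| ≤ 6 * (sqDir x y (cos θ))⁻¹) :
    |∫ θ in (-π)..π, y.1 * cos θ / (4 * π) * g θ| ≤ 600 * R⁻¹ := by
  have h := abs_integral_le_of_le_inv (f := fun θ => y.1 * cos θ / (4 * π) * g θ) hR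
    -- 600/π = 6 · 400 / (4π).
    (M := 600 / π) (fun θ hθ => by
      have h1 := sqDir_cos_lower hx hy hx1 hθ
      rw [← hR2] at h1
      have h0 : 0 < (R ^ 2 + θ ^ 2) / 400 := by positivity
      have h2 : (sqDir x y (cos θ))⁻¹ ≤ ((R ^ 2 + θ ^ 2) / 400)⁻¹ := by gcongr
      have h3 := abs_mul_le_mul (abs_fst_mul_cos_div_le hy θ)
        ((hg θ (h0.trans_le h1)).trans (mul_le_mul_of_nonneg_left h2 (by norm_num)))
      refine h3.trans (le_of_eq ?_)
      field_simp
      norm_num)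
  refine h.trans (le_of_eq ?_)
  field_simp

lemma abs_axisymGreenDr_le (hx : x ∈ halfDisc) (hy : y ∈ halfDisc)
    (hx1 : 1 / 2 ≤ x.1) (hR : 0 < R) (hR2 : R ^ 2 = (x.1 - y.1) ^ 2 + (x.2 - y.2) ^ 2) :
    |axisymGreenDr x y| ≤ 600 * R⁻¹ :=
  abs_integral_kernel_le hx hy hx1 hR hR2 fun θ h => abs_greenDr_le hx hy (abs_cos_le_one θ) h

lemma abs_axisymGreenDz_le (hx : x ∈ halfDisc) (hy : y ∈ halfDisc)
    (hx1 : 1 / 2 ≤ x.1) (hR : 0 < R) (hR2 : R ^ 2 = (x.1 - y.1) ^ 2 + (x.2 - y.2) ^ 2) :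
    |axisymGreenDz x y| ≤ 600 * R⁻¹ :=
  abs_integral_kernel_le hx hy hx1 hR hR2 fun θ h => abs_greenDz_le hx hy (abs_cos_le_one θ) h

/-- If `g - g'` is `-κ |e₁ - y_θ|⁻⁵` up to a second order error, its angular average is the
corresponding multiple of `|e₁ - y|⁻⁴`. -/
lemma abs_integral_kernel_sub_le {g g' : ℝ → ℝ} {κ : ℝ} (hy : y ∈ halfDisc)
    (hR : 0 < R) (hR2 : R ^ 2 = (1 - y.1) ^ 2 + y.2 ^ 2) (hg : Continuous g) (hg' : Continuous g')
    (h : ∀ θ, |g θ - g' θ + κ * (√(sqDir (1, 0) y (cos θ)))⁻¹ ^ 5|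
      ≤ 7000 * ρ ^ 2 * (√(sqDir (1, 0) y (cos θ)))⁻¹ ^ 4) :
    |(∫ θ in (-π)..π, y.1 * cos θ / (4 * π) * g θ) - (∫ θ in (-π)..π, y.1 * cos θ / (4 * π) * g' θ)
      + y.1 / (4 * π) * κ * ∫ θ in (-π)..π, cos θ * (√(sqDir (1, 0) y (cos θ)))⁻¹ ^ 5|
      ≤ 300000000 * ρ ^ 2 * R⁻¹ ^ 3 := by
  have hcont := continuous_inv_sqrt_sqDir_e1 hy hR hR2
  have hc0 : Continuous fun θ => y.1 * cos θ / (4 * π) := by fun_prop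
  have e : (∫ θ in (-π)..π, y.1 * cos θ / (4 * π) * g θ)
      - (∫ θ in (-π)..π, y.1 * cos θ / (4 * π) * g' θ)
      + y.1 / (4 * π) * κ * ∫ θ in (-π)..π, cos θ * (√(sqDir (1, 0) y (cos θ)))⁻¹ ^ 5
      = ∫ θ in (-π)..π, y.1 * cos θ / (4 * π)
        * (g θ - g' θ + κ * (√(sqDir (1, 0) y (cos θ)))⁻¹ ^ 5) := by
    have i1 : IntervalIntegrable (fun θ => y.1 * cos θ / (4 * π) * g θ) volume (-π) π :=
      (hc0.mul hg).intervalIntegrable _ _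
    have i2 : IntervalIntegrable (fun θ => y.1 * cos θ / (4 * π) * g' θ) volume (-π) π :=
      (hc0.mul hg').intervalIntegrable _ _
    have i3 : IntervalIntegrable (fun θ => y.1 / (4 * π) * κ
        * (cos θ * (√(sqDir (1, 0) y (cos θ)))⁻¹ ^ 5)) volume (-π) π :=
      ((continuous_cos.mul (hcont.pow 5)).const_mul (y.1 / (4 * π) * κ)).intervalIntegrable _ _
    rw [← intervalIntegral.integral_const_mul, ← intervalIntegral.integral_sub i1 i2,
      ← intervalIntegral.integral_add (i1.sub i2) i3]
    congr 1
    ext θ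
    ring
  rw [e]
  -- 280000000/π = 7000 · 160000 / (4π).
  refine (abs_integral_le_of_le_inv hR (M := 280000000 / π * ρ ^ 2 * R⁻¹ ^ 2)
    (fun θ hθ => ?_)).trans ?_
  · have h1 := inv_sqrt_sqDir_e1_pow_four_le hy hR hR2 hθ
    refine (abs_mul_le_mul (abs_fst_mul_cos_div_le hy θ) ((h θ).trans
      (mul_le_mul_of_nonneg_left h1 (by positivity)))).trans (le_of_eq ?_)
    field_simp
    ring
  · have : 0 ≤ ρ ^ 2 * R⁻¹ ^ 3 := by positivity
    calc 280000000 / π * ρ ^ 2 * R⁻¹ ^ 2 * (π / R) = 280000000 * (ρ ^ 2 * R⁻¹ ^ 3) := by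
          field_simp
      _ ≤ _ := by linarith

/-- Comparison of the leading part of the kernel with `-(4/π) c (1-r) z / |e₁ - y|⁴`. -/
lemma abs_leading_part_sub_le {c J : ℝ} (hy : y ∈ halfDisc) (hR : 0 < R)
    (hR2 : R ^ 2 = (1 - y.1) ^ 2 + y.2 ^ 2) (hx1 : 1 / 2 ≤ x.1) (hxρ : |1 - x.1| ≤ ρ) (hc : |c| ≤ ρ)
    (hρR : ρ ≤ R) (hJ : |J - 4 / 3 * R⁻¹ ^ 4| ≤ 200000000 * R⁻¹ ^ 3) :
    |y.1 / x.1 * (y.1 / (4 * π) * (6 * y.2 * c * (1 - (y.1 ^ 2 + y.2 ^ 2))) * J)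
      - 4 / π * c * ((1 - y.1) * y.2 / R ^ 4)| ≤ 900000000 * ρ * R⁻¹ := by
  have hρ : 0 ≤ ρ := (abs_nonneg _).trans hc
  have hr0 := hy.1
  have hr1 : y.1 ≤ 1 := by nlinarith [hy.2, sq_nonneg y.2]
  have hx0 : 0 < x.1 := by linarith
  have hz : |y.2| ≤ R := abs_le_of_sq_le_sq (by nlinarith [sq_nonneg (1 - y.1)]) hR.le
  have hX : |1 - y.1| ≤ R := abs_le_of_sq_le_sq (by nlinarith [sq_nonneg y.2]) hR.le
  set k := y.1 ^ 2 / x.1 with hk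
  have hk0 : 0 ≤ k := by positivity
  have hk2 : k ≤ 2 := by rw [hk, div_le_iff₀ hx0]; nlinarith
  have hk1 : |k - 1| ≤ 6 * R := by
    have e : k - 1 = (-(1 - y.1) * (1 + y.1) + (1 - x.1)) * x.1⁻¹ := by
      rw [hk]; field_simp; ring
    have h1 : |x.1⁻¹| ≤ 2 := by
      rw [abs_of_nonneg (by positivity), inv_le_comm₀ hx0 two_pos]; linarith
    have h2 : |-(1 - y.1) * (1 + y.1)| ≤ R * 2 := by
      rw [neg_mul, abs_neg]
      exact abs_mul_le_mul hX (by rw [abs_of_nonneg] <;> linarith)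
    rw [e]
    refine (abs_mul_le_mul ((abs_add_le _ _).trans (add_le_add h2 hxρ)) h1).trans ?_
    linarith
  have hq : 1 - (y.1 ^ 2 + y.2 ^ 2) = 2 * (1 - y.1) - R ^ 2 := by rw [hR2]; ring
  have hq0 : |2 * (1 - y.1) - R ^ 2| ≤ 2 * R := by
    rw [← hq, abs_of_nonneg (by linarith [hy.2])]
    rw [hq]; nlinarith [(abs_le.mp hX).2]
  have hb : |2 * (1 - y.1) * (k - 1) - k * R ^ 2| ≤ 14 * R ^ 2 := by
    have h1 : |2 * (1 - y.1)| ≤ 2 * R := by rw [abs_mul, abs_two]; gcongr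
    have h2 := abs_mul_le_mul h1 hk1
    have h3 : |k * R ^ 2| ≤ 2 * R ^ 2 := by rw [abs_of_nonneg (by positivity)]; gcongr
    refine (abs_sub _ _).trans ((add_le_add h2 h3).trans (le_of_eq ?_))
    ring
  have hzc := abs_mul_le_mul hz hc
  have hπ : 3 < π := Real.pi_gt_three
  have hπi : |2 / π| ≤ 1 := by
    rw [abs_of_nonneg (by positivity), div_le_one pi_pos]; linarith
  have hπi' : |3 / (2 * π)| ≤ 1 := by
    rw [abs_of_nonneg (by positivity), div_le_one (by positivity)]; linarith
  -- Three approximations are separated: k ≈ 1, 1 - |y|² ≈ 2(1 - r) and J ≈ (4/3)R⁻⁴. The constant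
  -- of the theorem arises as 6/(4π) · 2 · 4/3 = 4/π.
  have e : y.1 / x.1 * (y.1 / (4 * π) * (6 * y.2 * c * (1 - (y.1 ^ 2 + y.2 ^ 2))) * J)
      - 4 / π * c * ((1 - y.1) * y.2 / R ^ 4)
      = 2 / π * (y.2 * c * (2 * (1 - y.1) * (k - 1) - k * R ^ 2)) * R⁻¹ ^ 4
        + 3 / (2 * π) * (y.2 * c * (2 * (1 - y.1) - R ^ 2)) * (k * (J - 4 / 3 * R⁻¹ ^ 4)) := by
    rw [hq, hk]
    field_simp
    ring
  rw [e]
  have a1 := abs_mul_le_mul (abs_mul_le_mul hπi (abs_mul_le_mul hzc hb))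
    (abs_of_nonneg (by positivity : 0 ≤ R⁻¹ ^ 4)).le
  have a2 := abs_mul_le_mul (abs_mul_le_mul hπi' (abs_mul_le_mul hzc hq0))
    (abs_mul_le_mul ((abs_of_nonneg hk0).le.trans hk2) hJ)
  refine (abs_add_le _ _).trans ((add_le_add a1 a2).trans ?_)
  have : 0 ≤ ρ * R⁻¹ := by positivity
  calc _ = 800000014 * (ρ * R⁻¹) := by field_simp; ring
    _ ≤ _ := by linarith

/-- The kernel of the axial velocity. -/
def kerZ (x y : ℝ × ℝ) : ℝ := y.1 / x.1 * axisymGreenDr x y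

/-- The kernel of the radial velocity. -/
def kerR (x y : ℝ × ℝ) : ℝ := -(y.1 / x.1 * axisymGreenDz x y)

lemma abs_fst_div_le (hy : y ∈ halfDisc) (hx1 : 1 / 2 ≤ x.1) : |y.1 / x.1| ≤ 2 := by
  have := hy.1
  have hx0 : 0 < x.1 := by linarith
  rw [abs_of_nonneg (by positivity), div_le_iff₀ hx0]
  nlinarith [hy.2, sq_nonneg y.2]

lemma abs_kerZ_le (hx : x ∈ halfDisc) (hy : y ∈ halfDisc)
    (hx1 : 1 / 2 ≤ x.1) (hR : 0 < R) (hR2 : R ^ 2 = (x.1 - y.1) ^ 2 + (x.2 - y.2) ^ 2) :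
    |kerZ x y| ≤ 1200 * R⁻¹ :=
  (abs_mul_le_mul (abs_fst_div_le hy hx1) (abs_axisymGreenDr_le hx hy hx1 hR hR2)).trans
    (le_of_eq (by ring))

lemma abs_kerR_le (hx : x ∈ halfDisc) (hy : y ∈ halfDisc)
    (hx1 : 1 / 2 ≤ x.1) (hR : 0 < R) (hR2 : R ^ 2 = (x.1 - y.1) ^ 2 + (x.2 - y.2) ^ 2) :
    |kerR x y| ≤ 1200 * R⁻¹ := by
  rw [kerR, abs_neg]
  exact (abs_mul_le_mul (abs_fst_div_le hy hx1) (abs_axisymGreenDz_le hx hy hx1 hR hR2)).trans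
    (le_of_eq (by ring))

lemma ne_of_far (hxρ : (1 - x.1) ^ 2 + x.2 ^ 2 ≤ ρ ^ 2) (hρ : 0 ≤ ρ) (hR : 0 < R)
    (hR2 : R ^ 2 = (1 - y.1) ^ 2 + y.2 ^ 2) (hρR : 8 * ρ ≤ R) : x ≠ y := by
  rintro rfl
  nlinarith

lemma abs_kernel_odd_le {c D D' : ℝ} (hy : y ∈ halfDisc) (hx1 : 1 / 2 ≤ x.1)
    (hR : 0 < R) (hR2 : R ^ 2 = (1 - y.1) ^ 2 + y.2 ^ 2) (hxρ : |1 - x.1| ≤ ρ) (hc : |c| ≤ ρ)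
    (hρR : ρ ≤ R)
    (h : |D - D' + y.1 / (4 * π) * (6 * y.2 * c * (1 - (y.1 ^ 2 + y.2 ^ 2)))
      * ∫ θ in (-π)..π, cos θ * (√(sqDir (1, 0) y (cos θ)))⁻¹ ^ 5|
      ≤ 300000000 * ρ ^ 2 * R⁻¹ ^ 3) :
    |y.1 / x.1 * D - y.1 / x.1 * D' + 4 / π * c * ((1 - y.1) * y.2 / R ^ 4)|
      ≤ 1000000000 * (ρ ^ 2 * R⁻¹ ^ 3 + ρ * R⁻¹) := by
  have h1 := abs_leading_part_sub_le hy hR hR2 hx1 hxρ hc hρR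
    (abs_integral_cos_mul_inv_pow_five_sub_le hy hR hR2)
  have h2 := abs_mul_le_mul (abs_fst_div_le (x := x) hy hx1) h
  have hρ : 0 ≤ ρ := (abs_nonneg _).trans hc
  have h3 : 0 ≤ ρ ^ 2 * R⁻¹ ^ 3 := by positivity
  have h4 : 0 ≤ ρ * R⁻¹ := by positivity
  rw [abs_le] at *
  constructor <;> linarith

lemma abs_kerZ_odd_le (hx : x ∈ halfDisc) (hy : y ∈ halfDisc) (hx1 : 1 / 2 ≤ x.1)
    (hρ : 0 ≤ ρ) (hxρ : (1 - x.1) ^ 2 + x.2 ^ 2 ≤ ρ ^ 2) (hR : 0 < R)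
    (hR2 : R ^ 2 = (1 - y.1) ^ 2 + y.2 ^ 2) (hρR : 8 * ρ ≤ R) :
    |kerZ x y - kerZ x (y.1, -y.2) + 4 / π * x.2 * ((1 - y.1) * y.2 / R ^ 4)|
      ≤ 1000000000 * (ρ ^ 2 * R⁻¹ ^ 3 + ρ * R⁻¹) := by
  have hX : |1 - x.1| ≤ ρ := abs_le_of_sq_le_sq (by nlinarith [sq_nonneg x.2]) hρ
  have hZ : |x.2| ≤ ρ := abs_le_of_sq_le_sq (by nlinarith [sq_nonneg (1 - x.1)]) hρ
  refine abs_kernel_odd_le hy hx1 hR hR2 hX hZ (by linarith) ?_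
  refine abs_integral_kernel_sub_le hy hR hR2
    (continuous_greenDr hx hy (ne_of_far hxρ hρ hR hR2 hρR))
    (continuous_greenDr hx (halfDisc_neg hy)
      (ne_of_far hxρ hρ hR (by simpa using hR2) hρR)) fun θ => ?_
  have ha := le_sqrt_sqDir_e1 hy hR2 (cos_le_one θ)
  exact greenDr_odd_expansion hx hy (abs_cos_le_one θ) hρ hxρ (hR.trans_le ha) (hρR.trans ha)

lemma abs_kerR_odd_le (hx : x ∈ halfDisc) (hy : y ∈ halfDisc) (hx1 : 1 / 2 ≤ x.1)
    (hρ : 0 ≤ ρ) (hxρ : (1 - x.1) ^ 2 + x.2 ^ 2 ≤ ρ ^ 2) (hR : 0 < R)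
    (hR2 : R ^ 2 = (1 - y.1) ^ 2 + y.2 ^ 2) (hρR : 8 * ρ ≤ R) :
    |kerR x y - kerR x (y.1, -y.2) + 4 / π * (1 - x.1) * ((1 - y.1) * y.2 / R ^ 4)|
      ≤ 1000000000 * (ρ ^ 2 * R⁻¹ ^ 3 + ρ * R⁻¹) := by
  have hX : |1 - x.1| ≤ ρ := abs_le_of_sq_le_sq (by nlinarith [sq_nonneg x.2]) hρ
  have hX' : |-(1 - x.1)| ≤ ρ := by rwa [abs_neg]
  -- `kerR` carries a minus sign, so the common estimate is applied to the z̄-derivative with c =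
  -- -(1 - r̄) and then negated.
  rw [← abs_neg]
  have key := abs_kernel_odd_le (D := axisymGreenDz x y) (D' := axisymGreenDz x (y.1, -y.2))
    hy hx1 hR hR2 hX hX' (by linarith) ?_
  · refine le_of_eq_of_le (congrArg _ ?_) key
    simp only [kerR]
    ring
  refine abs_integral_kernel_sub_le hy hR hR2
    (continuous_greenDz hx hy (ne_of_far hxρ hρ hR hR2 hρR))
    (continuous_greenDz hx (halfDisc_neg hy)
      (ne_of_far hxρ hρ hR (by simpa using hR2) hρR)) fun θ => ?_
  have ha := le_sqrt_sqDir_e1 hy hR2 (cos_le_one θ)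
  refine le_of_eq_of_le (congrArg _ ?_) (greenDz_odd_expansion hx hy (abs_cos_le_one θ) hρ hxρ
    (hR.trans_le ha) (hρR.trans ha))
  ring

end Kernel

/-! ### The velocity as an integral against a kernel -/

section Velocity

lemma measurable_kernel_integral {g : (ℝ × ℝ) → ℝ → ℝ}
    (hg : Measurable (Function.uncurry g)) :
    Measurable fun y : ℝ × ℝ => ∫ θ in (-π)..π, y.1 * cos θ / (4 * π) * g y (cos θ) := by
  have h : StronglyMeasurable (Function.uncurry fun (y : ℝ × ℝ) (θ : ℝ) =>
      y.1 * cos θ / (4 * π) * g y (cos θ)) := by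
    refine Measurable.stronglyMeasurable ?_
    refine Measurable.mul (by fun_prop) ?_
    exact hg.comp (by fun_prop : Measurable fun p : (ℝ × ℝ) × ℝ => (p.1, cos p.2))
  simp_rw [intervalIntegral.integral_of_le (by linarith [pi_pos] : -π ≤ π)]
  exact (h.integral_prod_right (ν := volume.restrict (Ioc (-π) π))).measurable

lemma measurable_kerZ (x : ℝ × ℝ) : Measurable (kerZ x) := by
  refine Measurable.mul (by fun_prop) (measurable_kernel_integral ?_)
  unfold Function.uncurry greenDr sqDir sqIm
  fun_prop

lemma measurable_kerR (x : ℝ × ℝ) : Measurable (kerR x) := by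
  refine (Measurable.mul (by fun_prop) (measurable_kernel_integral ?_)).neg
  unfold Function.uncurry greenDz sqDir sqIm
  fun_prop

lemma isClosed_halfDisc : IsClosed halfDisc := by
  have h1 : IsClosed {y : ℝ × ℝ | 0 ≤ y.1} := isClosed_le continuous_const continuous_fst
  have h2 : IsClosed {y : ℝ × ℝ | y.1 ^ 2 + y.2 ^ 2 ≤ 1} :=
    isClosed_le (by fun_prop) continuous_const
  exact h1.inter h2

lemma measurableSet_halfDisc : MeasurableSet halfDisc := isClosed_halfDisc.measurableSet

lemma ae_fst_ne_zero : ∀ᵐ y : ℝ × ℝ, y.1 ≠ 0 := by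
  have h : (volume : Measure (ℝ × ℝ)) (({0} : Set ℝ) ×ˢ univ) = 0 := by
    rw [Measure.volume_eq_prod, Measure.prod_prod]
    simp
  rw [ae_iff]
  convert h using 2
  ext y
  simp

lemma ae_areaD_pos (x : ℝ × ℝ) : ∀ᵐ y ∂areaD, y ∈ halfDisc ∧ 0 < y.1 ∧ x ≠ y := by
  filter_upwards [ae_restrict_mem measurableSet_halfDisc, ae_restrict_of_ae ae_fst_ne_zero,
    ae_restrict_of_ae (Measure.ae_ne volume x)] with y h1 h2 h3
  exact ⟨h1, lt_of_le_of_ne h1.1 h2.symm, h3.symm⟩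

lemma velZ_eq {x : ℝ × ℝ} (hx : x ∈ halfDisc) (w : ℝ × ℝ → ℝ) :
    velZ w x = ∫ y, kerZ x y * w y ∂areaD := by
  unfold velZ
  rw [← integral_const_mul]
  refine integral_congr_ae ?_
  filter_upwards [ae_areaD_pos x] with y ⟨h1, h2, h3⟩
  rw [deriv_axisymGreen_fst hx h1 h3 h2, kerZ]
  ring

lemma velR_eq {x : ℝ × ℝ} (hx : x ∈ halfDisc) (w : ℝ × ℝ → ℝ) :
    velR w x = ∫ y, kerR x y * w y ∂areaD := by
  unfold velR
  rw [← integral_const_mul, ← integral_neg]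
  refine integral_congr_ae ?_
  filter_upwards [ae_areaD_pos x] with y ⟨h1, h2, h3⟩
  rw [deriv_axisymGreen_snd hx h1 h3 h2, kerR]
  ring

/-- The velocity is tangent to the sphere. -/
lemma vel_tangent {x : ℝ × ℝ} (hx : x ∈ halfDisc) (hx1 : x.1 ^ 2 + x.2 ^ 2 = 1)
    (w : ℝ × ℝ → ℝ) : x.1 * velR w x + x.2 * velZ w x = 0 := by
  have h : ∀ y, x.1 * (kerR x y * w y) = -(x.2 * (kerZ x y * w y)) := by
    intro y
    simp only [kerR, kerZ]
    linear_combination (-(y.1 / x.1) * w y) * axisymGreenDz_mul_eq hx1 y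
  rw [velR_eq hx, velZ_eq hx, ← integral_const_mul, ← integral_const_mul]
  simp_rw [h]
  rw [integral_neg]
  ring

end Velocity

/-! ### Radial integrals in the plane, for the supremum norm -/

/-- `‖v‖⁻¹` cut off to `‖v‖ < s`. -/
def nearProfile (s : ℝ) (v : ℝ × ℝ) : ℝ := (Iio s).indicator (fun t => t⁻¹) ‖v‖

/-- `‖v‖⁻³` cut off to `s ≤ ‖v‖`. -/
def farProfile (s : ℝ) (v : ℝ × ℝ) : ℝ := (Ici s).indicator (fun t => t⁻¹ ^ 3) ‖v‖

lemma nearProfile_nonneg (s : ℝ) (v : ℝ × ℝ) : 0 ≤ nearProfile s v :=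
  indicator_apply_nonneg fun _ => by positivity

lemma farProfile_nonneg (s : ℝ) (v : ℝ × ℝ) : 0 ≤ farProfile s v :=
  indicator_apply_nonneg fun _ => by positivity

lemma nearProfile_of_lt {s : ℝ} {v : ℝ × ℝ} (h : ‖v‖ < s) : nearProfile s v = ‖v‖⁻¹ :=
  indicator_of_mem (mem_Iio.mpr h) _

lemma farProfile_of_le {s : ℝ} {v : ℝ × ℝ} (h : s ≤ ‖v‖) : farProfile s v = ‖v‖⁻¹ ^ 3 :=
  indicator_of_mem (mem_Ici.mpr h) _

lemma measureReal_ball_prod : (volume : Measure (ℝ × ℝ)).real (Metric.ball 0 1) = 4 := by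
  rw [measureReal_def, show (0 : ℝ × ℝ) = (0, 0) from rfl, ← ball_prod_same,
    Measure.volume_eq_prod, Measure.prod_prod, Real.volume_ball]
  rw [← ENNReal.ofReal_mul (by norm_num), ENNReal.toReal_ofReal (by norm_num)]
  norm_num

lemma nearProfile_integrand {s t : ℝ} (ht : t ∈ Ioi (0 : ℝ)) :
    t ^ (Module.finrank ℝ (ℝ × ℝ) - 1) • (Iio s).indicator (fun t : ℝ => t⁻¹) t
      = (Iio s).indicator 1 t := by
  have ht0 : t ≠ 0 := (mem_Ioi.mp ht).ne'
  by_cases h : t ∈ Iio s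
  · simp [h, ht0]
  · simp [h]

lemma integrable_nearProfile (s : ℝ) : Integrable (nearProfile s) := by
  refine (integrable_fun_norm_addHaar (volume : Measure (ℝ × ℝ))).mpr ?_
  rw [integrableOn_congr_fun (fun t ht => nearProfile_integrand ht) measurableSet_Ioi,
    IntegrableOn, integrable_indicator_iff measurableSet_Iio, IntegrableOn,
    Measure.restrict_restrict measurableSet_Iio]
  exact integrableOn_const (by rw [inter_comm, Ioi_inter_Iio]; simp)

/-- The factor 8 is the dimension 2 times the area 4 of the unit ball of the supremum norm. -/
lemma integral_nearProfile {s : ℝ} (hs : 0 ≤ s) : ∫ v, nearProfile s v = 8 * s := by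
  have h := integral_fun_norm_addHaar (volume : Measure (ℝ × ℝ))
    ((Iio s).indicator fun t : ℝ => t⁻¹)
  unfold nearProfile
  rw [h, measureReal_ball_prod,
    setIntegral_congr_fun measurableSet_Ioi (fun t ht => nearProfile_integrand ht),
    setIntegral_indicator measurableSet_Iio, Ioi_inter_Iio]
  simp [hs]
  ring

lemma farProfile_integrand {s t : ℝ} (ht : t ∈ Ioi (0 : ℝ)) :
    t ^ (Module.finrank ℝ (ℝ × ℝ) - 1) • (Ici s).indicator (fun t : ℝ => t⁻¹ ^ 3) t
      = (Ici s).indicator (fun t => t ^ (-2 : ℝ)) t := by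
  have ht0 : 0 < t := mem_Ioi.mp ht
  by_cases h : t ∈ Ici s
  · rw [indicator_of_mem h, indicator_of_mem h, Real.rpow_neg ht0.le]
    simp
    field_simp
  · simp [h]

lemma integrable_farProfile {s : ℝ} (hs : 0 < s) : Integrable (farProfile s) := by
  refine (integrable_fun_norm_addHaar (volume : Measure (ℝ × ℝ))).mpr ?_
  rw [integrableOn_congr_fun (fun t ht => farProfile_integrand ht) measurableSet_Ioi,
    IntegrableOn, integrable_indicator_iff measurableSet_Ici, IntegrableOn,
    Measure.restrict_restrict measurableSet_Ici, inter_eq_left.mpr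
      (Ici_subset_Ioi.mpr hs), ← IntegrableOn, integrableOn_Ici_iff_integrableOn_Ioi]
  exact integrableOn_Ioi_rpow_of_lt (by norm_num) hs

lemma integral_farProfile {s : ℝ} (hs : 0 < s) : ∫ v, farProfile s v = 8 * s⁻¹ := by
  have h := integral_fun_norm_addHaar (volume : Measure (ℝ × ℝ))
    ((Ici s).indicator fun t : ℝ => t⁻¹ ^ 3)
  unfold farProfile
  rw [h, measureReal_ball_prod,
    setIntegral_congr_fun measurableSet_Ioi (fun t ht => farProfile_integrand ht),
    setIntegral_indicator measurableSet_Ici, inter_eq_right.mpr (Ici_subset_Ioi.mpr hs),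
    integral_Ici_eq_integral_Ioi, integral_Ioi_rpow_of_lt (by norm_num) hs]
  simp
  rw [show (-2 + 1 : ℝ) = -1 by norm_num, Real.rpow_neg_one]
  ring

/-- Inverse powers of the Euclidean distance are thereby dominated by the same powers of the
supremum norm, whose radial integrals are available. -/
lemma norm_prod_le_sqrt (v : ℝ × ℝ) : ‖v‖ ≤ √(v.1 ^ 2 + v.2 ^ 2) := by
  rw [Prod.norm_def, Real.norm_eq_abs, Real.norm_eq_abs]
  exact max_le (Real.abs_le_sqrt (by nlinarith [sq_nonneg v.2]))
    (Real.abs_le_sqrt (by nlinarith [sq_nonneg v.1]))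

/-! ### Odd functions on the half disc -/

/-- The reflection in the plane `z = 0`. -/
def reflZ (y : ℝ × ℝ) : ℝ × ℝ := (y.1, -y.2)

lemma measurePreserving_reflZ : MeasurePreserving reflZ areaD areaD := by
  have h : MeasurePreserving reflZ (volume : Measure (ℝ × ℝ)) volume := by
    rw [Measure.volume_eq_prod]
    exact (MeasurePreserving.id volume).prod (Measure.measurePreserving_neg volume)
  have h2 := h.restrict_preimage measurableSet_halfDisc
  have e : reflZ ⁻¹' halfDisc = halfDisc := by
    ext y; simp [reflZ, halfDisc]
  rwa [e] at h2

lemma measurableEmbedding_reflZ : MeasurableEmbedding reflZ :=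
  ((MeasurableEquiv.refl ℝ).prodCongr (MeasurableEquiv.neg ℝ)).measurableEmbedding

/-- Reflection gives 2∫ h w = ∫ (h - h ∘ `reflZ`) w, so a bound on the odd difference of h suffices.
The factor 1/2 is given away. -/
lemma abs_integral_mul_odd_le {h M w : ℝ × ℝ → ℝ} {B : ℝ} (hh : Integrable h areaD)
    (hM : Integrable M areaD) (hw : AEStronglyMeasurable w areaD) (hodd : OddInZ w)
    (hwB : ∀ᵐ y ∂areaD, |w y| ≤ B) (hhM : ∀ᵐ y ∂areaD, |h y - h (reflZ y)| ≤ M y) :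
    |∫ y, h y * w y ∂areaD| ≤ B * ∫ y, M y ∂areaD := by
  have hwB' : ∀ᵐ y ∂areaD, ‖w y‖ ≤ B := hwB
  have hhr : Integrable (fun y => h (reflZ y)) areaD :=
    measurePreserving_reflZ.integrable_comp_of_integrable hh
  have i1 : Integrable (fun y => h y * w y) areaD := hh.mul_bdd hw hwB'
  have i2 : Integrable (fun y => h (reflZ y) * w y) areaD := hhr.mul_bdd hw hwB'
  have e1 : ∫ y, h (reflZ y) * w y ∂areaD = -∫ y, h y * w y ∂areaD := by
    have e := measurePreserving_reflZ.integral_comp measurableEmbedding_reflZ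
      (fun y => h y * w (reflZ y))
    have e' : ∀ y, reflZ (reflZ y) = y := fun y => by simp [reflZ]
    simp only [e'] at e
    rw [e, ← integral_neg]
    refine integral_congr_ae ?_
    filter_upwards [hodd] with y hy
    simp only [reflZ]
    rw [hy]; ring
  have e2 : 2 * ∫ y, h y * w y ∂areaD = ∫ y, (h y - h (reflZ y)) * w y ∂areaD := by
    simp_rw [sub_mul]
    rw [integral_sub i1 i2, e1]; ring
  have h3 : |∫ y, (h y - h (reflZ y)) * w y ∂areaD| ≤ ∫ y, M y * B ∂areaD := by
    rw [← Real.norm_eq_abs]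
    refine norm_integral_le_of_norm_le (hM.mul_const B) ?_
    filter_upwards [hwB, hhM] with y h1 h2
    exact abs_mul_le_mul h2 h1
  rw [integral_mul_const] at h3
  have h4 : |2 * ∫ y, h y * w y ∂areaD| = 2 * |∫ y, h y * w y ∂areaD| := by
    rw [abs_mul, abs_two]
  rw [← e2, h4] at h3
  linarith [abs_nonneg (∫ y, h y * w y ∂areaD), mul_comm B (∫ y, M y ∂areaD)]

/-! ### The velocity in terms of the integral over `Q` -/

/-- The kernel of `mainIntegral`. -/
def mainKer (y : ℝ × ℝ) : ℝ := (1 - y.1) * y.2 / ((1 - y.1) ^ 2 + y.2 ^ 2) ^ 2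

section Geometry

variable {x y : ℝ × ℝ} {N R ρ c : ℝ}

lemma mainKer_reflZ (y : ℝ × ℝ) : mainKer (reflZ y) = -mainKer y := by
  simp only [mainKer, reflZ]; ring

lemma abs_mainKer_le (hR : 0 < R) (hR2 : R ^ 2 = (1 - y.1) ^ 2 + y.2 ^ 2) :
    |mainKer y| ≤ 1 / 2 * R⁻¹ ^ 2 := by
  have h : |(1 - y.1) * y.2| ≤ R ^ 2 / 2 := by
    rw [hR2, abs_le]
    constructor <;> nlinarith [sq_nonneg (1 - y.1 - y.2), sq_nonneg (1 - y.1 + y.2)]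
  rw [mainKer, ← hR2, abs_div, abs_of_nonneg (by positivity : 0 ≤ (R ^ 2) ^ 2)]
  calc _ ≤ R ^ 2 / 2 / (R ^ 2) ^ 2 := by gcongr
    _ = _ := by field_simp

lemma abs_mainKer_le_of_small (hR : 0 < R) (hR2 : R ^ 2 = (1 - y.1) ^ 2 + y.2 ^ 2)
    (h : |1 - y.1| ≤ ρ ∨ |y.2| ≤ ρ) : |mainKer y| ≤ ρ * R⁻¹ ^ 3 := by
  have h1 : |1 - y.1| ≤ R := abs_le_of_sq_le_sq (by nlinarith [sq_nonneg y.2]) hR.le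
  have h2 : |y.2| ≤ R := abs_le_of_sq_le_sq (by nlinarith [sq_nonneg (1 - y.1)]) hR.le
  have h3 : |(1 - y.1) * y.2| ≤ ρ * R := by
    rcases h with h | h
    · exact abs_mul_le_mul h h2
    · rw [mul_comm]; exact abs_mul_le_mul h h1
  rw [mainKer, ← hR2, abs_div, abs_of_nonneg (by positivity : 0 ≤ (R ^ 2) ^ 2)]
  calc _ ≤ ρ * R / (R ^ 2) ^ 2 := by gcongr
    _ = _ := by field_simp

/-- A point that misses Q together with its mirror image violates one of the defining inequalities
with |z| in place of z. Either it is at distance at least N from e₁, or it lies in a strip 1 - r ≤ ρ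
or |z| ≤ ρ, where one factor of the numerator is small. -/
lemma abs_mainKer_le_of_notMem (hy : y ∈ halfDisc) (hN : 0 < N) (hR : 0 < R)
    (hR2 : R ^ 2 = (1 - y.1) ^ 2 + y.2 ^ 2) (hρ : 0 ≤ ρ) (h1 : 1 - x.1 ≤ ρ) (h2 : x.2 ≤ ρ)
    (hyQ : y ∉ Q N x) (hyQ' : reflZ y ∉ Q N x) : |mainKer y| ≤ N⁻¹ ^ 2 + ρ * R⁻¹ ^ 3 := by
  have hpos : 0 ≤ ρ * R⁻¹ ^ 3 := by positivity
  have hposN : 0 ≤ N⁻¹ ^ 2 := by positivity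
  have hy1 : y.1 ≤ 1 := by nlinarith [hy.2, hy.1, sq_nonneg y.2]
  have far : N ≤ R → |mainKer y| ≤ N⁻¹ ^ 2 + ρ * R⁻¹ ^ 3 := fun hNR => by
    have : R⁻¹ ^ 2 ≤ N⁻¹ ^ 2 := by gcongr
    have : 0 ≤ R⁻¹ ^ 2 := by positivity
    linarith [abs_mainKer_le hR hR2]
  have small : |1 - y.1| ≤ ρ ∨ |y.2| ≤ ρ → |mainKer y| ≤ N⁻¹ ^ 2 + ρ * R⁻¹ ^ 3 := fun h => by
    linarith [abs_mainKer_le_of_small hR hR2 h]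
  by_cases a1 : y.1 ≤ 1 - N
  · exact far (le_of_sq_le_sq (by nlinarith [sq_nonneg y.2]) hR.le)
  by_cases a2 : x.1 ≤ y.1
  · refine small (Or.inl ?_)
    rw [abs_of_nonneg (by linarith)]; linarith
  by_cases a3 : N ≤ |y.2|
  · refine far (le_of_sq_le_sq ?_ hR.le)
    rw [hR2, ← sq_abs y.2]; nlinarith [sq_nonneg (1 - y.1)]
  by_cases a4 : |y.2| ≤ x.2
  · exact small (Or.inr (a4.trans h2))
  push Not at a1 a2 a3 a4
  rcases le_total 0 y.2 with hz | hz
  · rw [abs_of_nonneg hz] at a3 a4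
    exact absurd ⟨hy, a1, a2, a4, a3⟩ hyQ
  · rw [abs_of_nonpos hz] at a3 a4
    exact absurd ⟨halfDisc_neg hy, a1, a2, a4, a3⟩ hyQ'

/-- For z̄ ≥ 0 the set Q lies in z > 0, so a point and its mirror image are never both in Q. -/
lemma indicator_mainKer_sub (hx2 : 0 ≤ x.2) (hy : y ∈ Q N x ∨ reflZ y ∈ Q N x) :
    (Q N x).indicator mainKer y - (Q N x).indicator mainKer (reflZ y) = mainKer y := by
  rcases hy with hy | hy
  · have : reflZ y ∉ Q N x := fun h => by
      have h1 := hy.2.2.2.1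
      have h2 := h.2.2.2.1
      simp only [reflZ] at h2
      linarith
    rw [indicator_of_mem hy, indicator_of_notMem this, sub_zero]
  · have : y ∉ Q N x := fun h => by
      have h1 := hy.2.2.2.1
      have h2 := h.2.2.2.1
      simp only [reflZ] at h1
      linarith
    rw [indicator_of_mem hy, indicator_of_notMem this, mainKer_reflZ]; ring

lemma four_div_pi_le : |4 / π| ≤ 2 := by
  rw [abs_of_nonneg (by positivity), div_le_iff₀ pi_pos]
  linarith [pi_gt_three]

/-- Points of Q are farther from e₁ than x is, so |c| ≤ R there and one power of the singularity is
gained. -/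
lemma abs_mul_indicator_mainKer_le (hx : x ∈ halfDisc) (hx2 : 0 ≤ x.2)
    (hc : c ^ 2 ≤ (1 - x.1) ^ 2 + x.2 ^ 2) (hR : 0 < R)
    (hR2 : R ^ 2 = (1 - y.1) ^ 2 + y.2 ^ 2) :
    |4 / π * c * (Q N x).indicator mainKer y| ≤ R⁻¹ := by
  by_cases hy : y ∈ Q N x
  · have hx1 : x.1 ≤ 1 := by nlinarith [hx.1, hx.2]
    have hcR : |c| ≤ R := by
      refine abs_le_of_sq_le_sq (hc.trans ?_) hR.le
      have h1 := hy.2.2.1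
      have h2 := hy.2.2.2.1
      rw [hR2]
      nlinarith
    rw [indicator_of_mem hy]
    refine (abs_mul_le_mul (abs_mul_le_mul four_div_pi_le hcR) (abs_mainKer_le hR hR2)).trans
      (le_of_eq ?_)
    field_simp
  · rw [indicator_of_notMem hy, mul_zero, abs_zero]; positivity

lemma measurableSet_Q (N : ℝ) (x : ℝ × ℝ) : MeasurableSet (Q N x) := by
  have h1 : MeasurableSet {y : ℝ × ℝ | 1 - N < y.1} :=
    measurableSet_lt measurable_const measurable_fst
  have h2 : MeasurableSet {y : ℝ × ℝ | y.1 < x.1} :=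
    measurableSet_lt measurable_fst measurable_const
  have h3 : MeasurableSet {y : ℝ × ℝ | x.2 < y.2} :=
    measurableSet_lt measurable_const measurable_snd
  have h4 : MeasurableSet {y : ℝ × ℝ | y.2 < N} :=
    measurableSet_lt measurable_snd measurable_const
  exact measurableSet_halfDisc.inter (h1.inter (h2.inter (h3.inter h4)))

lemma measurable_mainKer : Measurable mainKer := by
  unfold mainKer; fun_prop

lemma integral_indicator_mainKer_mul (N : ℝ) (x : ℝ × ℝ) (w : ℝ × ℝ → ℝ) :
    ∫ y, (Q N x).indicator mainKer y * w y ∂areaD = mainIntegral N w x := by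
  have h : ∀ y, (Q N x).indicator mainKer y * w y
      = (Q N x).indicator (fun y => mainKer y * w y) y := fun y => by
    by_cases hy : y ∈ Q N x <;> simp [hy]
  simp_rw [h]
  have hsub : Q N x ⊆ halfDisc := fun y hy => hy.1
  rw [integral_indicator (measurableSet_Q N x), areaD,
    Measure.restrict_restrict (measurableSet_Q N x), inter_eq_left.mpr hsub]
  rfl

lemma norm_sub_e1_le (hy : y ∈ halfDisc) : ‖y - (1, 0)‖ ≤ 1 := by
  have := hy.1
  have := hy.2
  rw [Prod.norm_def, max_le_iff]
  simp only [Prod.fst_sub, Prod.snd_sub, Real.norm_eq_abs, abs_le]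
  refine ⟨⟨?_, ?_⟩, ?_, ?_⟩ <;> nlinarith

lemma norm_sub_lt_four (hx : x ∈ halfDisc) (hy : y ∈ halfDisc) : ‖y - x‖ < 4 := by
  have h := norm_sub_le_norm_sub_add_norm_sub y (1, 0) x
  rw [norm_sub_rev (1, 0) x] at h
  linarith [norm_sub_e1_le hx, norm_sub_e1_le hy]

lemma norm_reflZ (y : ℝ × ℝ) : ‖reflZ y‖ = ‖y‖ := by
  simp [reflZ, Prod.norm_def]

lemma norm_reflZ_sub (x y : ℝ × ℝ) : ‖reflZ y - x‖ = ‖y - reflZ x‖ := by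
  rw [← norm_reflZ]
  congr 1
  ext <;> simp [reflZ, add_comm, sub_eq_add_neg]

end Geometry

/-! ### The remainder kernel and its majorant -/

section Main

/-- The majorant of the odd part of the remainder kernel. -/
def majorant (A N ρ : ℝ) (x y : ℝ × ℝ) : ℝ :=
  A * nearProfile (9 * ρ) (y - x) + A * nearProfile (9 * ρ) (y - reflZ x)
    + 4 * nearProfile (8 * ρ) (y - (1, 0)) + (A + 2) * ρ ^ 2 * farProfile (8 * ρ) (y - (1, 0))
    + (A + 2 * N⁻¹ ^ 2) * ρ * nearProfile 4 (y - (1, 0))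

/-- Every term integrates to a multiple of ρ; in particular ρ² · 8/(8ρ) = ρ for the far profile. The
coefficient of A is 72 + 72 + 1 + 32 = 177. -/
lemma integrable_majorant_and_integral (A N : ℝ) {ρ : ℝ} (hρ : 0 < ρ) (x : ℝ × ℝ) :
    Integrable (majorant A N ρ x) ∧
      ∫ y, majorant A N ρ x y = ρ * (177 * A + 258 + 64 * N⁻¹ ^ 2) := by
  have near : ∀ (k : ℝ) {s : ℝ} (p : ℝ × ℝ), 0 ≤ s →
      Integrable (fun y => k * nearProfile s (y - p)) ∧
        ∫ y, k * nearProfile s (y - p) = k * (8 * s) := fun k s p hs =>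
    ⟨((integrable_nearProfile s).comp_sub_right p).const_mul k, by
      rw [integral_const_mul, integral_sub_right_eq_self (nearProfile s), integral_nearProfile hs]⟩
  have far : ∀ (k : ℝ) {s : ℝ} (p : ℝ × ℝ), 0 < s →
      Integrable (fun y => k * farProfile s (y - p)) ∧
        ∫ y, k * farProfile s (y - p) = k * (8 * s⁻¹) := fun k s p hs =>
    ⟨((integrable_farProfile hs).comp_sub_right p).const_mul k, by
      rw [integral_const_mul, integral_sub_right_eq_self (farProfile s), integral_farProfile hs]⟩
  have add : ∀ {f g : ℝ × ℝ → ℝ} {a b : ℝ}, (Integrable f ∧ ∫ y, f y = a) →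
      (Integrable g ∧ ∫ y, g y = b) →
      Integrable (fun y => f y + g y) ∧ ∫ y, f y + g y = a + b := fun hf hg =>
    ⟨hf.1.add hg.1, by rw [integral_add hf.1 hg.1, hf.2, hg.2]⟩
  have h := add (add (add (add (near A x (by positivity : 0 ≤ 9 * ρ))
    (near A (reflZ x) (by positivity : 0 ≤ 9 * ρ))) (near 4 (1, 0) (by positivity : 0 ≤ 8 * ρ)))
    (far ((A + 2) * ρ ^ 2) (1, 0) (by positivity : 0 < 8 * ρ)))
    (near ((A + 2 * N⁻¹ ^ 2) * ρ) (1, 0) (by norm_num : (0 : ℝ) ≤ 4))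
  refine ⟨h.1, h.2.trans ?_⟩
  field_simp
  ring

lemma majorant_nonneg {A N ρ : ℝ} (hA : 0 ≤ A) (hρ : 0 ≤ ρ) (x y : ℝ × ℝ) :
    0 ≤ majorant A N ρ x y := by
  unfold majorant
  have h1 := nearProfile_nonneg (9 * ρ) (y - x)
  have h2 := nearProfile_nonneg (9 * ρ) (y - reflZ x)
  have h3 := nearProfile_nonneg (8 * ρ) (y - (1, 0))
  have h4 := farProfile_nonneg (8 * ρ) (y - (1, 0))
  have h5 := nearProfile_nonneg 4 (y - (1, 0))
  positivity

/-- The two regimes are split at ‖y - e₁‖ = 8ρ. Inside, y is within 9ρ of x and of its mirror image,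
and every kernel is bounded separately. Outside, the odd expansion of K cancels the main kernel on Q
and its reflection; off these sets the main kernel itself is small. -/
lemma abs_remainder_odd_le {K : ℝ × ℝ → ℝ} {A N ρ c : ℝ} {x y : ℝ × ℝ} (hx : x ∈ halfDisc)
    (hx2 : 0 ≤ x.2) (hN : 0 < N) (hρ : 0 < ρ) (hxρ : (1 - x.1) ^ 2 + x.2 ^ 2 ≤ ρ ^ 2)
    (hc : c ^ 2 ≤ (1 - x.1) ^ 2 + x.2 ^ 2) (hA : 0 ≤ A)
    (hK : ∀ y ∈ halfDisc, x ≠ y → |K y| ≤ A * ‖y - x‖⁻¹)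
    (hodd : ∀ y ∈ halfDisc, ∀ R, 0 < R → R ^ 2 = (1 - y.1) ^ 2 + y.2 ^ 2 → 8 * ρ ≤ R →
      |K y - K (reflZ y) + 4 / π * c * ((1 - y.1) * y.2 / R ^ 4)|
        ≤ A * (ρ ^ 2 * R⁻¹ ^ 3 + ρ * R⁻¹))
    (hy : y ∈ halfDisc) (hxy : x ≠ y) (hxy' : x ≠ reflZ y) (hy1 : y ≠ (1, 0)) :
    |(K y + 4 / π * c * (Q N x).indicator mainKer y)
      - (K (reflZ y) + 4 / π * c * (Q N x).indicator mainKer (reflZ y))| ≤ majorant A N ρ x y := by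
  have hv : 0 < ‖y - (1, 0)‖ := norm_pos_iff.mpr (sub_ne_zero.mpr hy1)
  have hvR := norm_prod_le_sqrt (y - (1, 0))
  have hxn : ‖x - (1, 0)‖ ≤ ρ := by
    refine (norm_prod_le_sqrt _).trans (Real.sqrt_le_iff.mpr ⟨hρ.le, ?_⟩)
    simp only [Prod.fst_sub, Prod.snd_sub, sub_zero]
    nlinarith
  simp only [Prod.fst_sub, Prod.snd_sub, sub_zero] at hvR
  have e0 : (y.1 - 1) ^ 2 + y.2 ^ 2 = (1 - y.1) ^ 2 + y.2 ^ 2 := by ring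
  rw [e0] at hvR
  set R := √((1 - y.1) ^ 2 + y.2 ^ 2) with hRdef
  have hR : 0 < R := hv.trans_le hvR
  have hR2 : R ^ 2 = (1 - y.1) ^ 2 + y.2 ^ 2 := Real.sq_sqrt (by positivity)
  have hR2' : R ^ 2 = (1 - (reflZ y).1) ^ 2 + (reflZ y).2 ^ 2 := by simpa [reflZ] using hR2
  have hinv : R⁻¹ ≤ ‖y - (1, 0)‖⁻¹ := by gcongr
  have n1 := mul_nonneg hA (nearProfile_nonneg (9 * ρ) (y - x))
  have n2 := mul_nonneg hA (nearProfile_nonneg (9 * ρ) (y - reflZ x))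
  have n3 := nearProfile_nonneg (8 * ρ) (y - (1, 0))
  have n4 : 0 ≤ (A + 2) * ρ ^ 2 * farProfile (8 * ρ) (y - (1, 0)) :=
    mul_nonneg (by positivity) (farProfile_nonneg _ _)
  have n5 : 0 ≤ (A + 2 * N⁻¹ ^ 2) * ρ * nearProfile 4 (y - (1, 0)) :=
    mul_nonneg (by positivity) (nearProfile_nonneg _ _)
  unfold majorant
  rcases lt_or_ge ‖y - (1, 0)‖ (8 * ρ) with h | h
  · have d1 : ‖y - x‖ < 9 * ρ := by
      have := norm_sub_le_norm_sub_add_norm_sub y (1, 0) x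
      rw [norm_sub_rev (1, 0) x] at this
      linarith
    have d2 : ‖y - reflZ x‖ < 9 * ρ := by
      have := norm_sub_le_norm_sub_add_norm_sub y (1, 0) (reflZ x)
      have e : ‖(1, 0) - reflZ x‖ = ‖x - (1, 0)‖ := by
        rw [norm_sub_rev, norm_reflZ_sub]; simp [reflZ]
      linarith
    have k1 := hK y hy hxy
    have k2 := hK (reflZ y) (halfDisc_neg hy) hxy'
    rw [norm_reflZ_sub] at k2
    have q1 := abs_mul_indicator_mainKer_le (N := N) hx hx2 hc hR hR2
    have q2 := abs_mul_indicator_mainKer_le (N := N) hx hx2 hc hR hR2'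
    rw [nearProfile_of_lt h] at *
    rw [nearProfile_of_lt d1] at *
    rw [nearProfile_of_lt d2] at *
    rw [abs_le] at *
    constructor <;> linarith
  · have o1 := hodd y hy R hR hR2 (h.trans hvR)
    have eR : (1 - y.1) * y.2 / R ^ 4 = mainKer y := by
      rw [mainKer, ← hR2]; ring
    rw [eR] at o1
    have hX : |c| ≤ ρ := abs_le_of_sq_le_sq (hc.trans hxρ) hρ.le
    have b2 : |4 / π * c * ((Q N x).indicator mainKer y - (Q N x).indicator mainKer (reflZ y)
        - mainKer y)| ≤ 2 * ρ * (N⁻¹ ^ 2 + ρ * R⁻¹ ^ 3) := by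
      refine abs_mul_le_mul (abs_mul_le_mul four_div_pi_le hX) ?_
      by_cases hyQ : y ∈ Q N x ∨ reflZ y ∈ Q N x
      · rw [indicator_mainKer_sub hx2 hyQ, sub_self, abs_zero]; positivity
      · push Not at hyQ
        rw [indicator_of_notMem hyQ.1, indicator_of_notMem hyQ.2, sub_zero, zero_sub, abs_neg]
        have hx1 : 1 - x.1 ≤ ρ := le_of_sq_le_sq (by nlinarith [sq_nonneg x.2]) hρ.le
        have hx2' : x.2 ≤ ρ := le_of_sq_le_sq (by nlinarith [sq_nonneg (1 - x.1)]) hρ.le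
        exact abs_mainKer_le_of_notMem hy hN hR hR2 hρ.le hx1 hx2' hyQ.1 hyQ.2
    have hlt : ‖y - (1, 0)‖ < 4 := (norm_sub_e1_le hy).trans_lt (by norm_num)
    have h1v : 1 ≤ ‖y - (1, 0)‖⁻¹ := (one_le_inv₀ hv).mpr (norm_sub_e1_le hy)
    rw [farProfile_of_le h, nearProfile_of_lt hlt]
    have e : (K y + 4 / π * c * (Q N x).indicator mainKer y)
        - (K (reflZ y) + 4 / π * c * (Q N x).indicator mainKer (reflZ y))
        = (K y - K (reflZ y) + 4 / π * c * mainKer y) + 4 / π * c * ((Q N x).indicator mainKer y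
          - (Q N x).indicator mainKer (reflZ y) - mainKer y) := by ring
    have hi3 : R⁻¹ ^ 3 ≤ ‖y - (1, 0)‖⁻¹ ^ 3 := by gcongr
    rw [e]
    calc _ ≤ A * (ρ ^ 2 * R⁻¹ ^ 3 + ρ * R⁻¹) + 2 * ρ * (N⁻¹ ^ 2 + ρ * R⁻¹ ^ 3) :=
          (abs_add_le _ _).trans (add_le_add o1 b2)
      _ = (A + 2) * ρ ^ 2 * R⁻¹ ^ 3 + A * ρ * R⁻¹ + 2 * N⁻¹ ^ 2 * ρ * 1 := by ring
      _ ≤ (A + 2) * ρ ^ 2 * ‖y - (1, 0)‖⁻¹ ^ 3 + A * ρ * ‖y - (1, 0)‖⁻¹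
          + 2 * N⁻¹ ^ 2 * ρ * ‖y - (1, 0)‖⁻¹ := by gcongr
      _ = (A + 2) * ρ ^ 2 * ‖y - (1, 0)‖⁻¹ ^ 3
          + (A + 2 * N⁻¹ ^ 2) * ρ * ‖y - (1, 0)‖⁻¹ := by ring
      _ ≤ _ := by
          have : 0 ≤ 4 * nearProfile (8 * ρ) (y - (1, 0)) := by positivity
          linarith

lemma abs_integral_kernel_add_mainIntegral_le {K w : ℝ × ℝ → ℝ} {A B N ρ c : ℝ} {x : ℝ × ℝ}
    (hx : x ∈ halfDisc) (hx2 : 0 ≤ x.2) (hN : 0 < N) (hρ : 0 < ρ)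
    (hxρ : (1 - x.1) ^ 2 + x.2 ^ 2 ≤ ρ ^ 2)
    (hc : c ^ 2 ≤ (1 - x.1) ^ 2 + x.2 ^ 2) (hA : 0 ≤ A) (hKm : Measurable K)
    (hK : ∀ y ∈ halfDisc, x ≠ y → |K y| ≤ A * ‖y - x‖⁻¹)
    (hodd : ∀ y ∈ halfDisc, ∀ R, 0 < R → R ^ 2 = (1 - y.1) ^ 2 + y.2 ^ 2 → 8 * ρ ≤ R →
      |K y - K (reflZ y) + 4 / π * c * ((1 - y.1) * y.2 / R ^ 4)|
        ≤ A * (ρ ^ 2 * R⁻¹ ^ 3 + ρ * R⁻¹))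
    (hw : AEStronglyMeasurable w areaD) (hwodd : OddInZ w) (hwB : ∀ᵐ y ∂areaD, |w y| ≤ B)
    (hB : 0 ≤ B) :
    |(∫ y, K y * w y ∂areaD) + 4 / π * c * mainIntegral N w x|
      ≤ B * (ρ * (177 * A + 258 + 64 * N⁻¹ ^ 2)) := by
  have hae : ∀ᵐ y ∂areaD, y ∈ halfDisc ∧ x ≠ y ∧ x ≠ reflZ y ∧ y ≠ (1, 0) := by
    filter_upwards [ae_restrict_mem measurableSet_halfDisc,
      ae_restrict_of_ae (Measure.ae_ne volume x),
      ae_restrict_of_ae (Measure.ae_ne volume (reflZ x)),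
      ae_restrict_of_ae (Measure.ae_ne volume (1, 0))] with y h1 h2 h3 h4
    refine ⟨h1, h2.symm, ?_, h4⟩
    rintro rfl
    simp [reflZ] at h3
  have iK : Integrable K areaD := by
    refine Integrable.mono' (((integrable_nearProfile 4).comp_sub_right x).restrict.const_mul A)
      hKm.aestronglyMeasurable ?_
    filter_upwards [hae] with y ⟨h1, h2, _⟩
    rw [nearProfile_of_lt (norm_sub_lt_four hx h1)]
    exact hK y h1 h2
  have iI : Integrable (fun y => 4 / π * c * (Q N x).indicator mainKer y) areaD := by
    refine Integrable.mono' ((integrable_nearProfile 4).comp_sub_right (1, 0)).restrict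
      ((measurable_mainKer.indicator (measurableSet_Q N x)).const_mul _).aestronglyMeasurable ?_
    filter_upwards [hae] with y ⟨h1, _, _, h4⟩
    have hv : 0 < ‖y - (1, 0)‖ := norm_pos_iff.mpr (sub_ne_zero.mpr h4)
    have hvR := norm_prod_le_sqrt (y - (1, 0))
    have hsq : √((y - (1, 0)).1 ^ 2 + (y - (1, 0)).2 ^ 2) ^ 2 = (1 - y.1) ^ 2 + y.2 ^ 2 := by
      rw [Real.sq_sqrt (by positivity)]
      simp only [Prod.fst_sub, Prod.snd_sub]; ring
    rw [nearProfile_of_lt ((norm_sub_e1_le h1).trans_lt (by norm_num))]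
    exact (abs_mul_indicator_mainKer_le hx hx2 hc (hv.trans_le hvR) hsq).trans (by gcongr)
  have hwB' : ∀ᵐ y ∂areaD, ‖w y‖ ≤ B := hwB
  have e : (∫ y, K y * w y ∂areaD) + 4 / π * c * mainIntegral N w x
      = ∫ y, (K y + 4 / π * c * (Q N x).indicator mainKer y) * w y ∂areaD := by
    simp_rw [add_mul]
    rw [integral_add (iK.mul_bdd hw hwB') (iI.mul_bdd hw hwB'), ← integral_indicator_mainKer_mul,
      ← integral_const_mul]
    simp_rw [mul_assoc]
  rw [e]
  have hmaj := integrable_majorant_and_integral A N hρ x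
  refine (abs_integral_mul_odd_le (iK.add iI) hmaj.1.restrict hw hwodd hwB ?_).trans ?_
  · filter_upwards [hae] with y ⟨h1, h2, h3, h4⟩
    exact abs_remainder_odd_le hx hx2 hN hρ hxρ hc hA hK hodd h1 h2 h3 h4
  · refine mul_le_mul_of_nonneg_left ?_ hB
    rw [← hmaj.2]
    exact setIntegral_le_integral hmaj.1
      (Filter.Eventually.of_forall fun y => majorant_nonneg hA hρ.le x y)

end Main

/-! ### Expansion of the velocity for bounded vorticity -/

lemma distE1_sq (x : ℝ × ℝ) : distE1 x ^ 2 = (1 - x.1) ^ 2 + x.2 ^ 2 := by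
  rw [distE1, Real.sq_sqrt (by positivity)]; ring

lemma ae_abs_le_supNormD {w : ℝ × ℝ → ℝ} (hw : MemLp w ⊤ areaD) :
    ∀ᵐ y ∂areaD, |w y| ≤ supNormD w := by
  have hfin : eLpNorm w ⊤ areaD ≠ ⊤ := hw.2.ne
  rw [eLpNorm_exponent_top] at hfin
  filter_upwards [ae_le_eLpNormEssSup (f := w) (μ := areaD)] with y hy
  rw [supNormD, eLpNorm_exponent_top, ← Real.norm_eq_abs, ← toReal_enorm]
  exact ENNReal.toReal_mono hfin hy

/-- The constant in the remainder bound. -/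
def remainderConst (N : ℝ) : ℝ := 177 * 1000000000 + 258 + 64 * N⁻¹ ^ 2

lemma remainderConst_pos (N : ℝ) : 0 < remainderConst N := by
  unfold remainderConst; positivity

section Velocity

variable {N : ℝ} {w : ℝ × ℝ → ℝ} {x : ℝ × ℝ}

/-- The majorant needs ρ > 0, while x may equal e₁. The estimate is therefore proved for all
positive ρ at least the distance, and ρ decreases to it. -/
lemma abs_kernel_add_mainIntegral_le {K : ℝ × ℝ → ℝ} {c : ℝ} (hN : 0 < N)
    (hw : MemLp w ⊤ areaD) (hodd : OddInZ w) (hx : x ∈ halfDisc) (hx2 : 0 ≤ x.2)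
    (hc : c ^ 2 ≤ (1 - x.1) ^ 2 + x.2 ^ 2) (hKm : Measurable K)
    (hK : ∀ y ∈ halfDisc, ∀ R, 0 < R → R ^ 2 = (x.1 - y.1) ^ 2 + (x.2 - y.2) ^ 2 →
      |K y| ≤ 1200 * R⁻¹)
    (hKodd : ∀ ρ, 0 ≤ ρ → (1 - x.1) ^ 2 + x.2 ^ 2 ≤ ρ ^ 2 → ∀ y ∈ halfDisc, ∀ R, 0 < R →
      R ^ 2 = (1 - y.1) ^ 2 + y.2 ^ 2 → 8 * ρ ≤ R →
      |K y - K (reflZ y) + 4 / π * c * ((1 - y.1) * y.2 / R ^ 4)|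
        ≤ 1000000000 * (ρ ^ 2 * R⁻¹ ^ 3 + ρ * R⁻¹)) :
    |(∫ y, K y * w y ∂areaD) + 4 / π * c * mainIntegral N w x|
      ≤ remainderConst N * supNormD w * distE1 x := by
  have hB : 0 ≤ supNormD w := ENNReal.toReal_nonneg
  have hC := remainderConst_pos N
  have hd : 0 ≤ distE1 x := Real.sqrt_nonneg _
  have hK' : ∀ y ∈ halfDisc, x ≠ y → |K y| ≤ 1000000000 * ‖y - x‖⁻¹ := by
    intro y hy hxy
    have hv : 0 < ‖y - x‖ := norm_pos_iff.mpr (sub_ne_zero.mpr hxy.symm)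
    have hvR := norm_prod_le_sqrt (y - x)
    have hsq : √((y - x).1 ^ 2 + (y - x).2 ^ 2) ^ 2 = (x.1 - y.1) ^ 2 + (x.2 - y.2) ^ 2 := by
      rw [Real.sq_sqrt (by positivity)]
      simp only [Prod.fst_sub, Prod.snd_sub]; ring
    refine (hK y hy _ (hv.trans_le hvR) hsq).trans ?_
    gcongr
    norm_num
  have key : ∀ ρ, 0 < ρ → distE1 x ≤ ρ →
      |(∫ y, K y * w y ∂areaD) + 4 / π * c * mainIntegral N w x|
        ≤ supNormD w * (ρ * remainderConst N) := by
    intro ρ hρ hdρ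
    have hxρ : (1 - x.1) ^ 2 + x.2 ^ 2 ≤ ρ ^ 2 := by rw [← distE1_sq]; gcongr
    exact abs_integral_kernel_add_mainIntegral_le hx hx2 hN hρ hxρ hc (by norm_num) hKm hK'
      (hKodd ρ hρ.le hxρ) hw.1 hodd (ae_abs_le_supNormD hw) hB
  refine le_of_forall_pos_le_add fun ε hε => ?_
  set E := remainderConst N * supNormD w with hE
  have hE0 : 0 ≤ E := by positivity
  have h := key (distE1 x + ε / (E + 1)) (by positivity) (by
    have : 0 ≤ ε / (E + 1) := by positivity
    linarith)
  refine h.trans ?_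
  have h2 : E * (ε / (E + 1)) ≤ ε := by
    rw [mul_div_assoc', div_le_iff₀ (by positivity)]
    nlinarith
  calc supNormD w * ((distE1 x + ε / (E + 1)) * remainderConst N)
      = E * distE1 x + E * (ε / (E + 1)) := by rw [hE]; ring
    _ ≤ _ := by linarith

lemma abs_velZ_add_mainIntegral_le (hN : 0 < N) (hw : MemLp w ⊤ areaD) (hodd : OddInZ w)
    (hx : x ∈ halfDisc) (hx1 : 1 / 2 ≤ x.1) (hx2 : 0 ≤ x.2) :
    |velZ w x + 4 / π * x.2 * mainIntegral N w x| ≤ remainderConst N * supNormD w * distE1 x := by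
  rw [velZ_eq hx]
  exact abs_kernel_add_mainIntegral_le hN hw hodd hx hx2 (by nlinarith [sq_nonneg (1 - x.1)])
    (measurable_kerZ x) (fun y hy R hR hR2 => abs_kerZ_le hx hy hx1 hR hR2)
    (fun ρ hρ hxρ y hy R hR hR2 h => abs_kerZ_odd_le hx hy hx1 hρ hxρ hR hR2 h)

lemma abs_velR_add_mainIntegral_le (hN : 0 < N) (hw : MemLp w ⊤ areaD) (hodd : OddInZ w)
    (hx : x ∈ halfDisc) (hx1 : 1 / 2 ≤ x.1) (hx2 : 0 ≤ x.2) :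
    |velR w x + 4 / π * (1 - x.1) * mainIntegral N w x|
      ≤ remainderConst N * supNormD w * distE1 x := by
  rw [velR_eq hx]
  exact abs_kernel_add_mainIntegral_le hN hw hodd hx hx2 (by nlinarith [sq_nonneg x.2])
    (measurable_kerR x) (fun y hy R hR hR2 => abs_kerR_le hx hy hx1 hR hR2)
    (fun ρ hρ hxρ y hy R hR hR2 h => abs_kerR_odd_le hx hy hx1 hρ hxρ hR hR2 h)

end Velocity

/-- The remainder is the error divided by c, and d ≤ c/s turns the bound E d into E c/s. If c = 0
then d = 0, the hypothesis forces u = 0, and b = 0 works. -/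
lemma exists_remainder {u c I E d s : ℝ} (hs : 0 < s) (hd : 0 ≤ d) (hE : 0 ≤ E) (hdc : s * d ≤ c)
    (h : |u + 4 / π * c * I| ≤ E * d) :
    ∃ b : ℝ, |b| ≤ E / s ∧ u = -(4 / π) * c * I + c * b := by
  rcases (mul_nonneg hs.le hd |>.trans hdc).eq_or_lt with hc | hc
  · have hd0 : d = 0 := by
      refine le_antisymm ?_ hd
      rw [← hc] at hdc
      exact nonpos_of_mul_nonpos_right hdc hs
    rw [hd0, mul_zero] at h
    have := abs_nonpos_iff.mp h
    exact ⟨0, by rw [abs_zero]; positivity, by rw [← hc] at this ⊢; linarith⟩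
  · refine ⟨(u + 4 / π * c * I) / c, ?_, by field_simp; ring⟩
    rw [abs_div, abs_of_pos hc, div_le_div_iff₀ hc hs]
    calc |u + 4 / π * c * I| * s ≤ E * d * s := by gcongr
      _ = E * (s * d) := by ring
      _ ≤ E * c := by gcongr

/-! ### Geometry of the sectors at e₁ -/

section Sector

variable {γ : ℝ} {x : ℝ × ℝ}

lemma distE1_polar {ρ φ : ℝ} (hρ : 0 ≤ ρ) : distE1 (1 - ρ * sin φ, ρ * cos φ) = ρ := by
  have h : (1 - ρ * sin φ - 1) ^ 2 + (ρ * cos φ) ^ 2 = ρ ^ 2 := by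
    linear_combination ρ ^ 2 * Real.sin_sq_add_cos_sq φ
  rw [distE1, h, Real.sqrt_sq hρ]

lemma D1_bounds (hγ0 : 0 < γ) (hx : x ∈ D1 γ) : 0 ≤ x.2 ∧ sin γ * distE1 x ≤ x.2 := by
  obtain ⟨-, ρ, φ, hρ, h1, h2, rfl⟩ := hx
  rw [distE1_polar hρ]
  have hcos : sin γ ≤ cos φ := by
    rw [← cos_pi_div_two_sub]
    exact cos_le_cos_of_nonneg_of_le_pi h1 (by linarith [pi_pos]) h2
  have h0 : 0 ≤ cos φ := cos_nonneg_of_mem_Icc ⟨by linarith [pi_pos], by linarith⟩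
  exact ⟨by positivity, by simp only; nlinarith⟩

lemma D2_bounds (hγ0 : 0 < γ) (hx : x ∈ D2 γ) :
    0 ≤ x.2 ∧ sin γ * distE1 x ≤ 1 - x.1 := by
  obtain ⟨-, ρ, φ, hρ, h1, h2, rfl⟩ := hx
  rw [distE1_polar hρ]
  have hsin : sin γ ≤ sin φ := sin_le_sin_of_le_of_le_pi_div_two (by linarith [pi_pos]) h2 h1
  have h0 : 0 ≤ cos φ := cos_nonneg_of_mem_Icc ⟨by linarith [pi_pos], by linarith⟩
  exact ⟨by positivity, by simp only; nlinarith⟩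

lemma half_le_fst (h : distE1 x < 1 / 4) : 1 / 2 ≤ x.1 := by
  have h1 : |x.1 - 1| ≤ distE1 x := Real.abs_le_sqrt (by nlinarith [sq_nonneg x.2])
  linarith [(abs_le.mp h1).1]

end Sector

lemma velocityExpansion_of_memLp {N γ : ℝ} (hN : 0 < N) (hγ0 : 0 < γ) (hγ : γ < π / 2)
    {w : ℝ × ℝ → ℝ} (hw : MemLp w ⊤ areaD) (hodd : OddInZ w) :
    VelocityExpansion N γ (1 / 4) (remainderConst N / sin γ * supNormD w) w (velR w) (velZ w) := by
  have hs : 0 < sin γ := sin_pos_of_pos_of_lt_pi hγ0 (by linarith [pi_pos])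
  have hB : 0 ≤ supNormD w := ENNReal.toReal_nonneg
  have hE : 0 ≤ remainderConst N * supNormD w := mul_nonneg (remainderConst_pos N).le hB
  have e : remainderConst N / sin γ * supNormD w = remainderConst N * supNormD w / sin γ := by ring
  rw [e]
  refine ⟨fun x hx hd => ?_, fun x hx hd => ?_⟩
  · obtain ⟨h1, h2⟩ := D1_bounds hγ0 hx
    exact exists_remainder hs (Real.sqrt_nonneg _) hE h2
      (abs_velZ_add_mainIntegral_le hN hw hodd hx.1 (half_le_fst hd) h1)
  · obtain ⟨h1, h2⟩ := D2_bounds hγ0 hx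
    exact exists_remainder hs (Real.sqrt_nonneg _) hE h2
      (abs_velR_add_mainIntegral_le hN hw hodd hx.1 (half_le_fst hd) h1)

lemma VelocityExpansion.mono {N γ δ M M' : ℝ} {w ur uz : ℝ × ℝ → ℝ}
    (h : VelocityExpansion N γ δ M w ur uz) (hM : M ≤ M') : VelocityExpansion N γ δ M' w ur uz :=
  ⟨fun x hx hd => (h.1 x hx hd).imp fun _ hb => ⟨hb.1.trans hM, hb.2⟩,
    fun x hx hd => (h.2 x hx hd).imp fun _ hb => ⟨hb.1.trans hM, hb.2⟩⟩

/-! ### The maximum principle for the transport equation -/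

lemma isCompact_halfDisc : IsCompact halfDisc := by
  refine Metric.isCompact_of_isClosed_isBounded isClosed_halfDisc ?_
  exact Metric.isBounded_closedBall.subset fun y hy =>
    mem_closedBall_iff_norm.mpr (norm_sub_e1_le hy)

open Filter Topology in
/-- At a point `x` of the half disc, the direction `-u - η x` points into the half disc if `u` is
tangent to the boundary and `η > 0`. -/
lemma eventually_add_smul_mem_halfDisc {x u : ℝ × ℝ} {η : ℝ} (hx : x ∈ halfDisc) (hη : 0 < η)
    (haxis : x.1 = 0 → u.1 = 0) (htan : x.1 ^ 2 + x.2 ^ 2 = 1 → x.1 * u.1 + x.2 * u.2 = 0) :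
    ∀ᶠ s in 𝓝[>] (0 : ℝ), x + s • (-u - η • x) ∈ halfDisc := by
  have h1 : ∀ᶠ s in 𝓝[>] (0 : ℝ), 0 ≤ (x + s • (-u - η • x)).1 := by
    rcases hx.1.eq_or_lt with h | h
    · have := haxis h.symm
      exact Eventually.of_forall fun s => by simp [← h, this]
    · have hc : Continuous fun s : ℝ => (x + s • (-u - η • x)).1 := by fun_prop
      have : ∀ᶠ s in 𝓝 (0 : ℝ), 0 < (x + s • (-u - η • x)).1 :=
        hc.continuousAt.eventually (lt_mem_nhds (by simpa using h))
      exact (this.filter_mono nhdsWithin_le_nhds).mono fun s hs => hs.le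
  have h2 : ∀ᶠ s in 𝓝[>] (0 : ℝ),
      (x + s • (-u - η • x)).1 ^ 2 + (x + s • (-u - η • x)).2 ^ 2 ≤ 1 := by
    have hx2 : x.1 ^ 2 + x.2 ^ 2 ≤ 1 := hx.2
    rcases hx2.eq_or_lt with h | h
    · have hu := htan h
      have hc : Continuous fun s : ℝ => s * (η ^ 2 + (u.1 ^ 2 + u.2 ^ 2)) := by fun_prop
      have : ∀ᶠ s in 𝓝 (0 : ℝ), s * (η ^ 2 + (u.1 ^ 2 + u.2 ^ 2)) < 2 * η :=
        hc.continuousAt.eventually (gt_mem_nhds (by simpa using hη))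
      filter_upwards [this.filter_mono nhdsWithin_le_nhds, self_mem_nhdsWithin] with s hs hs0
      have hs0 : 0 < s := hs0
      -- Orthogonality of x and u removes the mixed terms. Moving along -u alone leaves the disc to
      -- second order in s; the inward push ηx compensates at first order.
      have e : (x + s • (-u - η • x)).1 ^ 2 + (x + s • (-u - η • x)).2 ^ 2
          = (1 - s * η) ^ 2 + s ^ 2 * (u.1 ^ 2 + u.2 ^ 2) := by
        simp only [Prod.fst_add, Prod.snd_add, Prod.smul_fst, Prod.smul_snd, Prod.fst_sub,
          Prod.snd_sub, Prod.fst_neg, Prod.snd_neg, smul_eq_mul]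
        linear_combination (1 - s * η) ^ 2 * h - 2 * s * (1 - s * η) * hu
      rw [e]
      nlinarith
    · have hc : Continuous fun s : ℝ =>
          (x + s • (-u - η • x)).1 ^ 2 + (x + s • (-u - η • x)).2 ^ 2 := by fun_prop
      have : ∀ᶠ s in 𝓝 (0 : ℝ),
          (x + s • (-u - η • x)).1 ^ 2 + (x + s • (-u - η • x)).2 ^ 2 < 1 :=
        hc.continuousAt.eventually (gt_mem_nhds (by simpa using h))
      exact (this.filter_mono nhdsWithin_le_nhds).mono fun s hs => hs.le
  filter_upwards [h1, h2] with s a b using ⟨a, b⟩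

open Filter Topology in
/-- Maximum principle for the transport equation with a velocity tangent to the boundary. -/
lemma le_of_transport {f : ℝ × (ℝ × ℝ) → ℝ} {f' : ℝ × (ℝ × ℝ) → ℝ × (ℝ × ℝ) →L[ℝ] ℝ}
    {u : ℝ → ℝ × ℝ → ℝ × ℝ} {M : ℝ}
    (hf : ∀ p ∈ Ici 0 ×ˢ halfDisc, HasFDerivWithinAt f (f' p) (Ici 0 ×ˢ halfDisc) p)
    (haxis : ∀ t, 0 ≤ t → ∀ x ∈ halfDisc, x.1 = 0 → (u t x).1 = 0)
    (htan : ∀ t, 0 ≤ t → ∀ x ∈ halfDisc, x.1 ^ 2 + x.2 ^ 2 = 1 →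
      x.1 * (u t x).1 + x.2 * (u t x).2 = 0)
    (htrans : ∀ t, 0 ≤ t → ∀ x ∈ halfDisc, f' (t, x) (1, u t x) = 0)
    (h0 : ∀ x ∈ halfDisc, f (0, x) ≤ M) {T : ℝ} (hT : 0 ≤ T) {x : ℝ × ℝ} (hx : x ∈ halfDisc) :
    f (T, x) ≤ M := by
  suffices h : ∀ ε, 0 < ε → f (T, x) ≤ M + ε * T by
    refine le_of_forall_pos_le_add fun ε hε => (h (ε / (T + 1)) (by positivity)).trans ?_
    have : ε / (T + 1) * T ≤ ε := by
      rw [div_mul_eq_mul_div, div_le_iff₀ (by positivity)]; nlinarith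
    linarith
  intro ε hε
  set S : Set (ℝ × (ℝ × ℝ)) := Ici 0 ×ˢ halfDisc with hS
  set K : Set (ℝ × (ℝ × ℝ)) := Icc 0 T ×ˢ halfDisc with hK
  have hKS : K ⊆ S := prod_mono Icc_subset_Ici_self subset_rfl
  have hcomp : IsCompact K := isCompact_Icc.prod isCompact_halfDisc
  have hcont : ContinuousOn (fun p : ℝ × (ℝ × ℝ) => f p - ε * p.1) K :=
    ContinuousOn.sub (fun p hp => (hf p (hKS hp)).continuousWithinAt.mono hKS) (by fun_prop)
  obtain ⟨⟨t₀, x₀⟩, hp, hmax⟩ := hcomp.exists_isMaxOn ⟨(T, x), ⟨hT, le_rfl⟩, hx⟩ hcont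
  have hle : f (T, x) - ε * T ≤ f (t₀, x₀) - ε * t₀ :=
    hmax (show (T, x) ∈ K from ⟨⟨hT, le_rfl⟩, hx⟩)
  have ht₀ : 0 ≤ t₀ := hp.1.1
  have hx₀ : x₀ ∈ halfDisc := hp.2
  rcases ht₀.eq_or_lt with h | ht
  · rw [← h] at hle
    linarith [h0 x₀ hx₀]
  exfalso
  set L := f' (t₀, x₀)
  have hder : HasFDerivWithinAt (fun p : ℝ × (ℝ × ℝ) => f p - ε * p.1)
      (L - ε • ContinuousLinearMap.fst ℝ ℝ (ℝ × ℝ)) K (t₀, x₀) :=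
    ((hf (t₀, x₀) (hKS hp)).mono hKS).sub
      ((ContinuousLinearMap.fst ℝ ℝ (ℝ × ℝ)).hasFDerivWithinAt.const_mul ε)
  -- At a maximum with t₀ > 0 the derivative of f - εt in the admissible direction (-1, -u - ηx₀) is
  -- nonpositive. The transport equation annihilates the (1, u) part, leaving ε - η L(0, x₀) ≤ 0,
  -- which is impossible for small η.
  have key : ∀ η, 0 < η → ε ≤ η * L (0, x₀) := by
    intro η hη
    have hcone : ((-1, -u t₀ x₀ - η • x₀) : ℝ × (ℝ × ℝ)) ∈ posTangentConeAt K (t₀, x₀) := by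
      refine mem_posTangentConeAt_of_frequently_mem (Eventually.frequently ?_)
      have h1 : ∀ᶠ s in 𝓝[>] (0 : ℝ), s < t₀ := (gt_mem_nhds ht).filter_mono nhdsWithin_le_nhds
      filter_upwards [eventually_add_smul_mem_halfDisc hx₀ hη (haxis t₀ ht₀ x₀ hx₀)
        (htan t₀ ht₀ x₀ hx₀), h1, self_mem_nhdsWithin] with s a b c
      have c : 0 < s := c
      have d : t₀ ≤ T := hp.1.2
      refine ⟨⟨?_, ?_⟩, a⟩ <;> simp <;> linarith
    have h := (IsMaxOn.localize hmax).hasFDerivWithinAt_nonpos hder hcone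
    have e : ((-1, -u t₀ x₀ - η • x₀) : ℝ × (ℝ × ℝ)) = -(1, u t₀ x₀) - η • (0, x₀) := by
      ext <;> simp
    have h2 : L (1, u t₀ x₀) = 0 := htrans t₀ ht₀ x₀ hx₀
    have h3 : L (-1, -u t₀ x₀ - η • x₀) = -(η * L (0, x₀)) := by
      rw [e, map_sub, map_neg, map_smul, h2]; simp
    simp only [sub_apply, smul_apply, h3,
      ContinuousLinearMap.coe_fst', smul_eq_mul] at h
    linarith
  have h2 := key (ε / (2 * (|L (0, x₀)| + 1))) (by positivity)
  rw [div_mul_eq_mul_div, le_div_iff₀ (by positivity)] at h2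
  nlinarith [le_abs_self (L (0, x₀)), abs_nonneg (L (0, x₀))]

/-! ### Solutions of the Euler equations -/

open Filter Topology in
/-- A continuous function on the half disc that vanishes on the arc off the axis vanishes on the
whole arc. -/
lemma eq_zero_on_arc {g : ℝ × ℝ → ℝ} (hg : ContinuousOn g halfDisc)
    (h0 : ∀ x ∈ halfDisc, x.1 ^ 2 + x.2 ^ 2 = 1 → 0 < x.1 → g x = 0) {x : ℝ × ℝ}
    (hx : x ∈ halfDisc) (hx1 : x.1 ^ 2 + x.2 ^ 2 = 1) : g x = 0 := by
  rcases hx.1.eq_or_lt with h | h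
  swap
  · exact h0 x hx hx1 h
  have hz : x.2 ^ 2 = 1 := by rw [← h] at hx1; linarith
  have hsq : ∀ a : ℝ, (sin a) ^ 2 + (x.2 * cos a) ^ 2 = 1 := fun a => by
    rw [mul_pow, hz, one_mul, sin_sq_add_cos_sq]
  -- The pole x = (0, ±1) is the endpoint a = 0 of this parametrized arc, which is off the axis for
  -- 0 < a < π.
  have hmem : ∀ a ∈ Icc (0 : ℝ) π, ((sin a, x.2 * cos a) : ℝ × ℝ) ∈ halfDisc := fun a ha =>
    ⟨sin_nonneg_of_mem_Icc ha, (hsq a).le⟩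
  have hx0 : ((sin 0, x.2 * cos 0) : ℝ × ℝ) = x := by ext <;> simp [← h]
  have hcont : ContinuousOn (fun a : ℝ => g (sin a, x.2 * cos a)) (Icc 0 π) :=
    hg.comp (by fun_prop) hmem
  have h1 : Tendsto (fun a : ℝ => g (sin a, x.2 * cos a)) (𝓝[>] 0) (𝓝 (g (sin 0, x.2 * cos 0))) :=
    (hcont 0 ⟨le_rfl, pi_pos.le⟩).mono_left
      ((nhdsWithin_Ioo_eq_nhdsGT pi_pos).symm.le.trans (nhdsWithin_mono _ Ioo_subset_Icc_self))
  have h2 : Tendsto (fun a : ℝ => g (sin a, x.2 * cos a)) (𝓝[>] 0) (𝓝 0) := by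
    refine tendsto_const_nhds.congr' ?_
    filter_upwards [Ioo_mem_nhdsGT pi_pos] with a ha
    exact (h0 _ (hmem a (Ioo_subset_Icc_self ha)) (hsq a) (sin_pos_of_mem_Ioo ha)).symm
  rw [← hx0]
  exact tendsto_nhds_unique h1 h2

open Filter Topology in
lemma halfDisc_subset_closure :
    halfDisc ⊆ closure {y : ℝ × ℝ | 0 < y.1 ∧ y.1 ^ 2 + y.2 ^ 2 < 1} := by
  intro x hx
  -- The segment from x to the interior point (1/2, 0).
  have hc : Continuous fun s : ℝ => (((1 - s) * x.1 + s / 2, (1 - s) * x.2) : ℝ × ℝ) := by fun_prop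
  have ht : Tendsto (fun s : ℝ => (((1 - s) * x.1 + s / 2, (1 - s) * x.2) : ℝ × ℝ)) (𝓝[>] 0)
      (𝓝 x) := by
    have := hc.tendsto 0
    simp only [sub_zero, one_mul, zero_div, add_zero] at this
    exact this.mono_left nhdsWithin_le_nhds
  refine mem_closure_of_tendsto ht ?_
  filter_upwards [Ioo_mem_nhdsGT one_pos] with s hs
  have hs0 := hs.1
  have hs1 : 0 < 1 - s := by linarith [hs.2]
  have h1 := hx.1
  have h2 : x.1 ^ 2 + x.2 ^ 2 ≤ 1 := hx.2
  have h3 : x.1 ≤ 1 := by nlinarith [sq_nonneg x.2]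
  refine ⟨by positivity, ?_⟩
  have e : ((1 - s) * x.1 + s / 2) ^ 2 + ((1 - s) * x.2) ^ 2
      = (1 - s) ^ 2 * (x.1 ^ 2 + x.2 ^ 2) + s * (1 - s) * x.1 + s ^ 2 / 4 := by ring
  have e1 : (1 - s) ^ 2 * (x.1 ^ 2 + x.2 ^ 2) ≤ (1 - s) ^ 2 :=
    mul_le_of_le_one_right (sq_nonneg _) h2
  have e2 : s * (1 - s) * x.1 ≤ s * (1 - s) := mul_le_of_le_one_right (by positivity) h3
  rw [e]
  nlinarith [hs.2]

/-- If the bound failed at one point, continuity would make it fail on a relative neighbourhood,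
which meets the open interior in a nonempty open set of positive measure. -/
lemma abs_le_of_ae_le {g : ℝ × ℝ → ℝ} {M : ℝ} (hg : ContinuousOn g halfDisc)
    (h : ∀ᵐ y ∂areaD, |g y| ≤ M) {x : ℝ × ℝ} (hx : x ∈ halfDisc) : |g x| ≤ M := by
  by_contra! hlt
  have hev := (hg x hx).abs.eventually (lt_mem_nhds hlt)
  obtain ⟨U, hU, hxU, hUsub⟩ := mem_nhdsWithin.mp hev
  have hO : IsOpen {y : ℝ × ℝ | 0 < y.1 ∧ y.1 ^ 2 + y.2 ^ 2 < 1} := by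
    have h1 : IsOpen {y : ℝ × ℝ | 0 < y.1} := isOpen_lt continuous_const continuous_fst
    have h2 : IsOpen {y : ℝ × ℝ | y.1 ^ 2 + y.2 ^ 2 < 1} :=
      isOpen_lt (by fun_prop) continuous_const
    exact h1.inter h2
  have hne := mem_closure_iff.mp (halfDisc_subset_closure hx) U hU hxU
  have hpos := (hU.inter hO).measure_pos volume hne
  have hsub : U ∩ {y : ℝ × ℝ | 0 < y.1 ∧ y.1 ^ 2 + y.2 ^ 2 < 1} ⊆ halfDisc :=
    fun y hy => ⟨hy.2.1.le, hy.2.2.le⟩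
  have hz : areaD (U ∩ {y : ℝ × ℝ | 0 < y.1 ∧ y.1 ^ 2 + y.2 ^ 2 < 1}) = 0 := by
    refine measure_mono_null (fun y hy => ?_) (ae_iff.mp h)
    exact not_le.mpr (hUsub ⟨hy.1, hsub hy⟩)
  rw [areaD, Measure.restrict_eq_self _ hsub] at hz
  exact hpos.ne' hz

lemma memLp_top_of_continuousOn {g : ℝ × ℝ → ℝ} (hg : ContinuousOn g halfDisc) :
    MemLp g ⊤ areaD := by
  obtain ⟨C, hC⟩ := isCompact_halfDisc.exists_bound_of_continuousOn hg
  refine memLp_top_of_bound (hg.aestronglyMeasurable measurableSet_halfDisc) C ?_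
  filter_upwards [ae_restrict_mem measurableSet_halfDisc] with y hy using hC y hy

section Euler

variable {w ur uz : ℝ → ℝ × ℝ → ℝ}

lemma IsEulerSolution.continuousOn_slice (h : IsEulerSolution w ur uz) {t : ℝ} (ht : 0 ≤ t) :
    ContinuousOn (w t) halfDisc :=
  h.contDiffOn_w.continuousOn.comp (f := fun x => (t, x)) (by fun_prop) fun _ hx => ⟨ht, hx⟩

/-- The Biot–Savart law is available only for r > 0, so the poles are reached by continuity of the
velocity. -/
lemma IsEulerSolution.tangent (h : IsEulerSolution w ur uz) {t : ℝ} (ht : 0 ≤ t) {x : ℝ × ℝ}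
    (hx : x ∈ halfDisc) (hx1 : x.1 ^ 2 + x.2 ^ 2 = 1) : x.1 * ur t x + x.2 * uz t x = 0 := by
  have c1 : ContinuousOn (ur t) halfDisc :=
    h.continuousOn_ur.comp (f := fun x => (t, x)) (by fun_prop) fun _ hx => ⟨ht, hx⟩
  have c2 : ContinuousOn (uz t) halfDisc :=
    h.continuousOn_uz.comp (f := fun x => (t, x)) (by fun_prop) fun _ hx => ⟨ht, hx⟩
  refine eq_zero_on_arc (g := fun x => x.1 * ur t x + x.2 * uz t x)
    ((continuousOn_fst.mul c1).add (continuousOn_snd.mul c2)) (fun y hy hy1 hy0 => ?_) hx hx1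
  rw [h.biotSavart_r t ht y hy hy0, h.biotSavart_z t ht y hy hy0, vel_tangent hy hy1]

lemma IsEulerSolution.abs_le_supNormD (h : IsEulerSolution w ur uz) {t : ℝ} (ht : 0 ≤ t)
    {x : ℝ × ℝ} (hx : x ∈ halfDisc) : |w t x| ≤ supNormD (w 0) := by
  have c0 := h.continuousOn_slice le_rfl
  have h0 : ∀ y ∈ halfDisc, |w 0 y| ≤ supNormD (w 0) := fun y hy =>
    abs_le_of_ae_le c0 (ae_abs_le_supNormD (memLp_top_of_continuousOn c0)) hy
  have hd := fun p hp =>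
    (h.contDiffOn_w.differentiableOn one_ne_zero p hp).hasFDerivWithinAt
  have hax : ∀ t, 0 ≤ t → ∀ x ∈ halfDisc, x.1 = 0 → ((ur t x, uz t x) : ℝ × ℝ).1 = 0 := h.axis
  have htan : ∀ t, 0 ≤ t → ∀ x ∈ halfDisc, x.1 ^ 2 + x.2 ^ 2 = 1 →
      x.1 * ((ur t x, uz t x) : ℝ × ℝ).1 + x.2 * ((ur t x, uz t x) : ℝ × ℝ).2 = 0 :=
    fun t ht x hx hx1 => h.tangent ht hx hx1
  rw [abs_le]
  constructor
  · have hneg := le_of_transport (f := fun p => -w p.1 p.2) (M := supNormD (w 0))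
      (u := fun t x => (ur t x, uz t x)) (fun p hp => (hd p hp).neg) hax htan
      (fun t ht x hx => neg_eq_zero.mpr (h.transport t ht x hx))
      (fun y hy => by
        have := (abs_le.mp (h0 y hy)).1
        simp only
        linarith) ht hx
    simp only at hneg
    linarith
  · exact le_of_transport (f := fun p => w p.1 p.2) (u := fun t x => (ur t x, uz t x))
      hd hax htan h.transport (fun y hy => (abs_le.mp (h0 y hy)).2) ht hx

lemma IsEulerSolution.supNormD_le (h : IsEulerSolution w ur uz) {t : ℝ} (ht : 0 ≤ t) :
    supNormD (w t) ≤ supNormD (w 0) := by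
  have h0 : 0 ≤ supNormD (w 0) := ENNReal.toReal_nonneg
  refine ENNReal.toReal_le_of_le_ofReal h0 ?_
  rw [eLpNorm_exponent_top]
  refine eLpNormEssSup_le_of_ae_bound ?_
  filter_upwards [ae_restrict_mem measurableSet_halfDisc] with y hy using h.abs_le_supNormD ht hy

end Euler

end AxisymEuler

end

theorem mainTheorem4 (N γ : ℝ) (hN0 : 0 < N) (hN : N < 1 / 2)
    (hγ0 : 0 < γ) (hγ : γ < Real.pi / 2) :
    ∃ δ C : ℝ, 0 < δ ∧
      -- every bounded vorticity profile that is odd in `z`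
      (∀ w : ℝ × ℝ → ℝ, MeasureTheory.MemLp w ⊤ AxisymEuler.areaD → AxisymEuler.OddInZ w →
        AxisymEuler.VelocityExpansion N γ δ (C * AxisymEuler.supNormD w) w
          (AxisymEuler.velR w) (AxisymEuler.velZ w)) ∧
      -- every solution of the Euler equations, at every time, in terms of the initial data
      (∀ w ur uz : ℝ → ℝ × ℝ → ℝ, AxisymEuler.IsEulerSolution w ur uz →
        ∀ t : ℝ, 0 ≤ t → AxisymEuler.OddInZ (w t) →
          AxisymEuler.VelocityExpansion N γ δ (C * AxisymEuler.supNormD (w 0)) (w t)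
            (ur t) (uz t)) := by
  have hs : 0 < Real.sin γ := Real.sin_pos_of_pos_of_lt_pi hγ0 (by linarith [Real.pi_pos])
  have hC : 0 ≤ AxisymEuler.remainderConst N / Real.sin γ :=
    div_nonneg (AxisymEuler.remainderConst_pos N).le hs.le
  refine ⟨1 / 4, AxisymEuler.remainderConst N / Real.sin γ, by norm_num,
    fun w hw hodd => AxisymEuler.velocityExpansion_of_memLp hN0 hγ0 hγ hw hodd,
    fun w ur uz h t ht hodd => ?_⟩
  -- The expansion is applied to the frozen profile w(·, t); the maximum principle then replaces its
  -- norm by that of the initial data.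
  have hexp := (AxisymEuler.velocityExpansion_of_memLp hN0 hγ0 hγ
    (AxisymEuler.memLp_top_of_continuousOn (h.continuousOn_slice ht)) hodd).mono
    (mul_le_mul_of_nonneg_left (h.supNormD_le ht) hC)
  refine ⟨fun x hx hd => ?_, fun x hx hd => ?_⟩
  · rw [h.biotSavart_z t ht x hx.1 (by linarith [AxisymEuler.half_le_fst hd])]
    exact hexp.1 x hx hd
  · rw [h.biotSavart_r t ht x hx.1 (by linarith [AxisymEuler.half_le_fst hd])]
    exact hexp.2 x hx hd
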